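/- Consider a queue with Poisson arrivals of rate $\lambda>0$ and $K$ groups of exponential servers. Group $k$ has $M_k$ servers, each with service rate $\mu_k>0$ and operating cost rate $c_k\ge 0$ while it is on; for $k\neq l$ the pairs $(c_k,\mu_k)$ and $(c_l,\mu_l)$ are different. The state $n\in\mathbb N$ is the number of customers in the system, and the holding cost rate $h(n)$ is increasing and convex with $h(n)\to\infty$. A policy $d$ assigns to each state $n$ the numbers $d(n,k)\in\{0,\dots,M_k\}$ of working servers of group $k$, subject to $\sum_k d(n,k)\le n$. Under $d$ the number of customers $n_t$ is the birth-death process with birth rate $\lambda$ and death rate $\sum_k d(n,k)\mu_k$ in state $n$, and the cost rate is $f(n,d(n))=h(n)+\sum_k d(n,k)c_k$. The long-run average cost is $\eta^d=\lim_{T\to\infty}\frac1T\,\mathbb E\int_0^T f(n_t,d(n_t))\,dt$. A policy is optimal if its long-run average cost is finite, the same from every initial state, and minimal over all policies and initial states. The performance potential $g$ of $d$ is, up to an additive constant, $g(n)=\mathbb E\big[\int_0^\infty (f(n_t,d(n_t))-\eta^d)\,dt \,\big|\, n_0=n\big]$, in the sense that $g(n)-g(0)=\lim_{T\to\infty}\big(\mathbb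 E[\int_0^T (f(n_t,d(n_t))-\eta^d)\,dt\mid n_0=n]-\mathbb E[\int_0^T (f(n_t,d(n_t))-\eta^d)\,dt\mid n_0=0]\big)$, and $G(n)=g(n)-g(n-1)$ for $n\ge1$. Assume scale economies: $c_1/\mu_1\le\dots\le c_K/\mu_K$ and $\mu_1\ge\dots\ge\mu_K$. Let $d^*$ be an optimal policy, with average cost $\eta^*$. Then its potential $g^*$ exists, and with $G^*(n)=g^*(n)-g^*(n-1)$ the following hold. 1. The thresholds $\theta_k=\min\{n\ge 1: G^*(n)>c_k/\mu_k\}$ are well defined (the sets are non-empty), and $\theta_1\le\theta_2\le\dots\le\theta_K$. 2. For all $k$ and all $n\ge\theta_k$, group $k$ has as many servers on as possible: $d^*(n,k)=M_k\wedge\big(n-\sum_{l<k}d^*(n,l)\big)$. 3. For all $k$ and all $n<\theta_k$, $d^*(n,k)=0$, unless $n\ge1$ and there is a tie $G^*(n)=c_k/\mu_k$. 4. The multi-threshold policy $d$ with these thresholds, given recursively in $k$ by $d(n,k)=M_k\wedge\big(n-\sum_{l<k}d(n,l)\big)$ if $n\ge\theta_k$ and $d(n,k)=0$ if $n<\theta_k$,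 is also optimal, with the same average cost $\eta^*$. -/

import Mathlib

/-- Data of a group-server queue with `K` groups: Poisson arrival rate `lam`, group sizes `M k`,
service rates `mu k`, operating cost rates `c k` (per working server), holding cost rate `h n`. -/
structure GroupServerQueue (K : ℕ) where
  lam : ℝ
  M : Fin K → ℕ
  mu : Fin K → ℝ
  c : Fin K → ℝ
  h : ℕ → ℝ

namespace GroupServerQueue

open Filter Topology MeasureTheory

variable {K : ℕ} (Q : GroupServerQueue K)

/-- A stationary policy `d` (with `d n k` the number of working servers of group `k` in state `n`)
is efficient if it respects the group sizes and never has more working servers than customers. -/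
def IsEfficient (d : ℕ → Fin K → ℕ) : Prop :=
  ∀ n, (∀ k, d n k ≤ Q.M k) ∧ ∑ k, d n k ≤ n

/-- Total service rate of an action. -/
noncomputable def serviceRate (m : Fin K → ℕ) : ℝ := ∑ k, (m k : ℝ) * Q.mu k

/-- Total cost rate: holding cost plus linear operating cost. -/
noncomputable def costRate (n : ℕ) (m : Fin K → ℕ) : ℝ := Q.h n + ∑ k, (m k : ℝ) * Q.c k

/-- Infinitesimal generator of the number of customers under an efficient policy `d`
(in state `0` an efficient policy has service rate `0`). -/
noncomputable def generator (d : ℕ → Fin K → ℕ) (n m : ℕ) : ℝ :=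
  if m = n + 1 then Q.lam
  else if n = m + 1 then Q.serviceRate (d n)
  else if m = n then -(Q.lam + Q.serviceRate (d n))
  else 0

/-- A uniform bound on the total transition rate out of any state under any policy. -/
noncomputable def unifRate : ℝ := Q.lam + ∑ k, (Q.M k : ℝ) * Q.mu k

/-- The uniformized one-step transition matrix `I + B / Λ`, with `B` the generator and `Λ` the
uniformization rate. -/
noncomputable def jump (d : ℕ → Fin K → ℕ) (n m : ℕ) : ℝ :=
  (if m = n then 1 else 0) + Q.generator d n m / Q.unifRate

/-- Powers of the uniformized matrix (row `n` of `jump` is supported in `{0, …, n + 1}`). -/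
noncomputable def jumpPow (d : ℕ → Fin K → ℕ) : ℕ → ℕ → ℕ → ℝ
  | 0, n, m => if m = n then 1 else 0
  | j + 1, n, m => ∑ l ∈ Finset.range (n + 2), Q.jump d n l * jumpPow d j l m

/-- Transition function `P(n_t = m | n_0 = n)` of the continuous-time Markov chain with generator
`B`, i.e. the `(n, m)` entry of `exp (t B) = ∑ⱼ e^{-Λt} (Λt)^j / j! (I + B/Λ)^j`: the chain jumps by
`I + B/Λ` at the points of a Poisson process of rate `Λ`. -/
noncomputable def trans (d : ℕ → Fin K → ℕ) (t : ℝ) (n m : ℕ) : ℝ :=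
  ∑' j : ℕ, Real.exp (-(Q.unifRate * t)) * (Q.unifRate * t) ^ j / (j.factorial : ℝ)
    * Q.jumpPow d j n m

/-- Expected cost rate at time `t` given `n_0 = n`. -/
noncomputable def meanCost (d : ℕ → Fin K → ℕ) (t : ℝ) (n : ℕ) : ℝ :=
  ∑' m : ℕ, Q.trans d t n m * Q.costRate m (d m)

/-- Started in state `n`, the queue under `d` has the finite long-run average cost `η`: expected
costs over finite horizons are finite, and their time averages converge to `η`. -/
def HasAverageCost (d : ℕ → Fin K → ℕ) (n : ℕ) (η : ℝ) : Prop :=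
  (∀ t : ℝ, 0 ≤ t → Summable fun m : ℕ => Q.trans d t n m * Q.costRate m (d m)) ∧
  (∀ T : ℝ, 0 ≤ T → IntervalIntegrable (fun t => Q.meanCost d t n) volume 0 T) ∧
  Tendsto (fun T : ℝ => 1 / T * ∫ t in (0 : ℝ)..T, Q.meanCost d t n) atTop (𝓝 η)

/-- `d` is an optimal efficient policy with optimal long-run average cost `η`: its cost is `η` from
every initial state, and no efficient policy has a smaller cost from any initial state. -/
def IsOptimal (d : ℕ → Fin K → ℕ) (η : ℝ) : Prop :=
  Q.IsEfficient d ∧ (∀ n, Q.HasAverageCost d n η) ∧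
  ∀ d', Q.IsEfficient d' → ∀ n η', Q.HasAverageCost d' n η' → η ≤ η'

/-- The expected accumulated excess cost `E[∫₀ᵀ (f(n_t, d(n_t)) - η) dt | n_0 = n]`. -/
noncomputable def excessCost (d : ℕ → Fin K → ℕ) (η : ℝ) (T : ℝ) (n : ℕ) : ℝ :=
  ∫ t in (0 : ℝ)..T, (Q.meanCost d t n - η)

/-- `g` is a performance potential (relative value function) of `d`, that is, up to an additive
constant, `g n = E[∫₀^∞ (f(n_t, d(n_t)) - η) dt | n_0 = n]`. Only differences of potentials matter;
they are the limits of the differences of the integrals over `[0, T]`, and these limits make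
sense also when the integrals over `[0, ∞)` do not converge individually. -/
def IsPotential (d : ℕ → Fin K → ℕ) (η : ℝ) (g : ℕ → ℝ) : Prop :=
  ∀ n, Tendsto (fun T : ℝ => Q.excessCost d η T n - Q.excessCost d η T 0) atTop (𝓝 (g n - g 0))

/-- The perturbation realization factor `G(n) = g(n) - g(n-1)`, meaningful for `n ≥ 1`. -/
def prf (g : ℕ → ℝ) (n : ℕ) : ℝ := g n - g (n - 1)

/-- The largest number of servers of group `k` that can be on in state `n` once the groups
`l < k` have `d n l` servers on: `M_k ∧ (n - ∑_{l<k} d(n,l))`. -/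
def maxOn (d : ℕ → Fin K → ℕ) (n : ℕ) (k : Fin K) : ℕ :=
  min (Q.M k) (n - ∑ l ∈ Finset.Iio k, d n l)

/-- `d` is the multi-threshold policy with thresholds `θ`. -/
def IsMultiThreshold (θ : Fin K → ℕ) (d : ℕ → Fin K → ℕ) : Prop :=
  ∀ n k, d n k = if θ k ≤ n then Q.maxOn d n k else 0

end GroupServerQueue

/-!
A finite average cost forces the queue to be positive recurrent, with a summable reversible weight
`w`, and the average cost is the `w`-mean of the cost rates. The potential increments `G` satisfy
the Poisson equation `lam * G (n + 1) = mu n * G n + η - f n`. Changing a policy in finitely many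
states changes the accumulated excess cost by the weighted sum of the changes of `f n - mu n * G n`,
so an optimal policy maximizes `∑ k, m k * (mu k * G n - c k)` over the allocations `m` in every
state `n`. Under scale economies a faster group that pays off is worth strictly more than the
groups after it, so this maximum is attained by filling the groups greedily, and the Poisson
equation becomes a scalar recursion `lam * G (n + 1) = η - h n + φ n (G n)`. Here `φ n` is monotone
with diminishing returns in `n` while `h` is convex, so once `G` decreases it decreases forever and
becomes negative, which is absurd for a policy that keeps serving. Hence `G` is monotone, the
thresholds exist, and the threshold policy solves the same Poisson equation, hence is optimal.
-/

open Filter Topology MeasureTheory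

namespace BirthDeath

/-! ### Poisson averages -/

section Poisson

open scoped ENNReal

/-- The Poisson probability of `j` at rate `r`, for a rate of any sign. -/
noncomputable def poissonWeight (r : ℝ) (j : ℕ) : ℝ :=
  Real.exp (-r) * r ^ j / (j.factorial : ℝ)

/-- The expectation of `a` under the Poisson distribution of rate `r`. -/
noncomputable def poissonAvg (r : ℝ) (a : ℕ → ℝ) : ℝ :=
  ∑' j : ℕ, poissonWeight r j * a j

variable {a b : ℕ → ℝ} {r C : ℝ}

theorem memℓp_infty_of_abs_le (ha : ∀ j, |a j| ≤ C) : Memℓp a ∞ :=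
  memℓp_infty ⟨C, Set.forall_mem_range.2 ha⟩

theorem exists_abs_le_of_memℓp_infty (ha : Memℓp a ∞) : ∃ C, ∀ j, |a j| ≤ C :=
  (memℓp_infty_iff.1 ha).imp fun _ h j => h ⟨j, rfl⟩

theorem memℓp_infty_succ (ha : Memℓp a ∞) : Memℓp (fun j => a (j + 1)) ∞ := by
  obtain ⟨C, hC⟩ := exists_abs_le_of_memℓp_infty ha
  exact memℓp_infty_of_abs_le fun j => hC (j + 1)

theorem summable_pow_div_factorial_mul (r : ℝ) (ha : Memℓp a ∞) :
    Summable fun j => r ^ j / (j.factorial : ℝ) * a j := by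
  obtain ⟨C, hC⟩ := exists_abs_le_of_memℓp_infty ha
  refine ((Real.summable_pow_div_factorial r).abs.mul_right C).of_norm_bounded fun j => ?_
  rw [Real.norm_eq_abs, abs_mul]
  exact mul_le_mul_of_nonneg_left (hC j) (abs_nonneg _)

theorem poissonWeight_nonneg (hr : 0 ≤ r) (j : ℕ) : 0 ≤ poissonWeight r j := by
  unfold poissonWeight; positivity

theorem poissonWeight_mul (r : ℝ) (a : ℕ → ℝ) (j : ℕ) :
    poissonWeight r j * a j = Real.exp (-r) * (r ^ j / (j.factorial : ℝ) * a j) := by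
  unfold poissonWeight; ring

theorem summable_poissonWeight_mul (r : ℝ) (ha : Memℓp a ∞) :
    Summable fun j => poissonWeight r j * a j := by
  simpa only [poissonWeight_mul] using (summable_pow_div_factorial_mul r ha).mul_left _

theorem poissonAvg_eq_exp_mul_tsum (r : ℝ) (a : ℕ → ℝ) :
    poissonAvg r a = Real.exp (-r) * ∑' j : ℕ, r ^ j / (j.factorial : ℝ) * a j := by
  simp only [poissonAvg, poissonWeight_mul, tsum_mul_left]

theorem hasSum_poissonWeight (r : ℝ) : HasSum (poissonWeight r) 1 := by
  have h := (NormedSpace.expSeries_div_hasSum_exp r).mul_left (Real.exp (-r))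
  rw [← Real.exp_eq_exp_ℝ, ← Real.exp_add, neg_add_cancel, Real.exp_zero] at h
  exact h.congr_fun fun j => mul_div_assoc _ _ _

theorem poissonAvg_const (r C : ℝ) : poissonAvg r (fun _ => C) = C := by
  rw [poissonAvg, ((hasSum_poissonWeight r).mul_right C).tsum_eq, one_mul]

theorem poissonAvg_sub (r : ℝ) (ha : Memℓp a ∞) (hb : Memℓp b ∞) :
    poissonAvg r (fun j => a j - b j) = poissonAvg r a - poissonAvg r b := by
  simp only [poissonAvg, mul_sub]
  exact (summable_poissonWeight_mul r ha).tsum_sub (summable_poissonWeight_mul r hb)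

theorem poissonAvg_const_mul (r C : ℝ) (a : ℕ → ℝ) :
    poissonAvg r (fun j => C * a j) = C * poissonAvg r a := by
  simp only [poissonAvg, mul_left_comm, tsum_mul_left]

theorem poissonAvg_mono (hr : 0 ≤ r) (ha : Memℓp a ∞) (hb : Memℓp b ∞) (hab : ∀ j, a j ≤ b j) :
    poissonAvg r a ≤ poissonAvg r b :=
  (summable_poissonWeight_mul r ha).tsum_le_tsum
    (fun j => mul_le_mul_of_nonneg_left (hab j) (poissonWeight_nonneg hr j))
    (summable_poissonWeight_mul r hb)

theorem poissonAvg_le (hr : 0 ≤ r) (ha : Memℓp a ∞) (haC : ∀ j, a j ≤ C) :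
    poissonAvg r a ≤ C := by
  simpa only [poissonAvg_const] using
    poissonAvg_mono hr ha (memℓp_infty_of_abs_le fun _ => le_rfl) haC

theorem abs_poissonAvg_le (hr : 0 ≤ r) (ha : ∀ j, |a j| ≤ C) : |poissonAvg r a| ≤ C :=
  abs_le.2 ⟨by
    have h := poissonAvg_mono hr (memℓp_infty_of_abs_le (a := fun _ => -C) fun _ => le_rfl)
      (memℓp_infty_of_abs_le ha) fun j => (abs_le.1 (ha j)).1
    rwa [poissonAvg_const] at h,
    poissonAvg_le hr (memℓp_infty_of_abs_le ha) fun j => (abs_le.1 (ha j)).2⟩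

theorem poissonAvg_zero_left (a : ℕ → ℝ) : poissonAvg 0 a = a 0 := by
  rw [poissonAvg, tsum_eq_single 0 fun j hj => by simp [poissonWeight, hj]]
  simp [poissonWeight]

theorem hasDerivAt_pow_succ_div_factorial (j : ℕ) (r : ℝ) :
    HasDerivAt (fun s : ℝ => s ^ (j + 1) / ((j + 1).factorial : ℝ))
      (r ^ j / (j.factorial : ℝ)) r := by
  refine ((hasDerivAt_pow (j + 1) r).div_const _).congr_deriv ?_
  rw [Nat.factorial_succ, Nat.add_sub_cancel]
  push_cast
  field_simp

theorem hasDerivAt_tsum_pow_div_factorial_mul (ha : Memℓp a ∞) (r : ℝ) :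
    HasDerivAt (fun s : ℝ => ∑' j : ℕ, s ^ j / (j.factorial : ℝ) * a j)
      (∑' j : ℕ, r ^ j / (j.factorial : ℝ) * a (j + 1)) r := by
  obtain ⟨C, hC⟩ := exists_abs_le_of_memℓp_infty ha
  have split_first (s : ℝ) : ∑' j : ℕ, s ^ j / (j.factorial : ℝ) * a j
      = a 0 + ∑' j : ℕ, s ^ (j + 1) / ((j + 1).factorial : ℝ) * a (j + 1) := by
    rw [(summable_pow_div_factorial_mul s ha).tsum_eq_zero_add]
    simp
  simp only [split_first]
  refine HasDerivAt.const_add _ (hasDerivAt_tsum_of_isPreconnected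
    (g := fun j s => s ^ (j + 1) / ((j + 1).factorial : ℝ) * a (j + 1))
    (g' := fun j s => s ^ j / (j.factorial : ℝ) * a (j + 1))
    (u := fun j => (|r| + 1) ^ j / (j.factorial : ℝ) * C)
    (t := Metric.ball (0 : ℝ) (|r| + 1)) (y₀ := r)
    ((Real.summable_pow_div_factorial _).mul_right C) Metric.isOpen_ball
    (convex_ball _ _).isPreconnected
    (fun j y _ => (hasDerivAt_pow_succ_div_factorial j y).mul_const _) (fun j y hy => ?_)
    (by simp) ?_ (by simp))
  · rw [mem_ball_zero_iff, Real.norm_eq_abs] at hy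
    rw [Real.norm_eq_abs, abs_mul, abs_div, abs_pow, Nat.abs_cast]
    have := hC (j + 1)
    gcongr
  · exact (summable_nat_add_iff 1).2 (summable_pow_div_factorial_mul r ha)

theorem hasDerivAt_poissonAvg (ha : Memℓp a ∞) (r : ℝ) :
    HasDerivAt (fun s => poissonAvg s a) (poissonAvg r (fun j => a (j + 1) - a j)) r := by
  have h := (hasDerivAt_neg r).exp.mul (hasDerivAt_tsum_pow_div_factorial_mul ha r)
  rw [poissonAvg_sub r (memℓp_infty_succ ha) ha]
  simp only [poissonAvg_eq_exp_mul_tsum]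
  exact h.congr_deriv (by ring)

theorem poissonWeight_succ_mul (r : ℝ) (j : ℕ) :
    poissonWeight r (j + 1) * ((j : ℝ) + 1) = r * poissonWeight r j := by
  rw [poissonWeight, poissonWeight, Nat.factorial_succ]
  push_cast
  field_simp
  ring

theorem hasSum_poissonWeight_mul_cast_mul {s : ℝ}
    (h : HasSum (fun j => poissonWeight r j * b (j + 1)) s) :
    HasSum (fun j => poissonWeight r j * (j * b j)) (r * s) := by
  have shifted : HasSum
      (fun j : ℕ => poissonWeight r (j + 1) * (((j + 1 : ℕ) : ℝ) * b (j + 1))) (r * s) := by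
    refine (h.mul_left r).congr_fun fun j => ?_
    rw [Nat.cast_succ, ← mul_assoc, poissonWeight_succ_mul, mul_assoc]
  simpa using (hasSum_nat_add_iff (f := fun j : ℕ => poissonWeight r j * (j * b j)) 1).1 shifted

theorem hasSum_poissonWeight_mul_sq (r : ℝ) :
    HasSum (fun j => poissonWeight r j * ((j : ℝ) - r) ^ 2) r := by
  have total := hasSum_poissonWeight r
  have mean := hasSum_poissonWeight_mul_cast_mul (b := fun _ => 1) (by simpa using total)
  have factorial_moment :
      HasSum (fun j : ℕ => poissonWeight r j * (j * ((j : ℝ) - 1))) (r * (r * 1)) :=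
    hasSum_poissonWeight_mul_cast_mul (b := fun j => (j : ℝ) - 1) (by simpa using mean)
  convert! (factorial_moment.add (mean.mul_left (1 - 2 * r))).add (total.mul_left (r ^ 2)) using 1
  · funext j; ring
  · ring

theorem mul_poissonAvg_diff (r : ℝ) (ha : Memℓp a ∞) :
    r * poissonAvg r (fun j => a (j + 1) - a j)
      = ∑' j : ℕ, poissonWeight r j * (((j : ℝ) - r) * a j) := by
  have h := (hasSum_poissonWeight_mul_cast_mul
    (summable_poissonWeight_mul r (memℓp_infty_succ ha)).hasSum).sub
    ((summable_poissonWeight_mul r ha).hasSum.mul_left r)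
  rw [poissonAvg_sub r (memℓp_infty_succ ha) ha, mul_sub]
  exact h.tsum_eq.symm.trans (tsum_congr fun j => by ring)

theorem abs_tsum_poissonWeight_mul_centered_le (hr : 0 < r) (ha : ∀ j, |a j| ≤ C) :
    |∑' j : ℕ, poissonWeight r j * (((j : ℝ) - r) * a j)| ≤ C * √r := by
  have : 0 < √r := Real.sqrt_pos.2 hr
  have amgm (x : ℝ) : |x| ≤ √r / 2 + 1 / (2 * √r) * x ^ 2 := by
    rw [← sub_nonneg, ← sq_abs x]
    have : √r / 2 + 1 / (2 * √r) * |x| ^ 2 - |x| = (√r - |x|) ^ 2 / (2 * √r) := by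
      field_simp
      ring
    rw [this]
    positivity
  have bound : HasSum (fun j => poissonWeight r j
      * ((√r / 2 + 1 / (2 * √r) * ((j : ℝ) - r) ^ 2) * C)) (C * √r) := by
    convert! (((hasSum_poissonWeight r).mul_left (√r / 2)).add
      ((hasSum_poissonWeight_mul_sq r).mul_left (1 / (2 * √r)))).mul_left C using 1
    · funext j; ring
    · have := Real.mul_self_sqrt hr.le
      field_simp
      linear_combination C * this
  rw [← Real.norm_eq_abs]
  refine tsum_of_norm_bounded bound fun j => ?_
  rw [Real.norm_eq_abs, abs_mul, abs_of_nonneg (poissonWeight_nonneg hr.le j), abs_mul]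
  have := poissonWeight_nonneg hr.le j
  have := ha j
  have := amgm (j - r)
  gcongr

theorem abs_poissonAvg_diff_le (hr : 0 < r) (ha : ∀ j, |a j| ≤ C) :
    |poissonAvg r (fun j => a (j + 1) - a j)| ≤ C / √r := by
  have h := abs_tsum_poissonWeight_mul_centered_le hr ha
  rw [← mul_poissonAvg_diff r (memℓp_infty_of_abs_le ha), abs_mul, abs_of_pos hr] at h
  have hs : 0 < √r := Real.sqrt_pos.2 hr
  rw [le_div_iff₀ hs]
  refine le_of_mul_le_mul_right ?_ hs
  rw [mul_assoc, Real.mul_self_sqrt hr.le, mul_comm]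
  exact h

theorem tendsto_poissonAvg_diff (ha : Memℓp a ∞) :
    Tendsto (fun r => poissonAvg r (fun j => a (j + 1) - a j)) atTop (𝓝 0) := by
  obtain ⟨C, hC⟩ := exists_abs_le_of_memℓp_infty ha
  refine squeeze_zero_norm' ?_ (tendsto_const_nhds (x := C).div_atTop Real.tendsto_sqrt_atTop)
  filter_upwards [eventually_gt_atTop 0] with r hr
  exact abs_poissonAvg_diff_le hr hC

end Poisson

/-! ### Birth-death semigroups -/

section Semigroup

open scoped ENNReal

/-- The generator of the birth-death process with birth rate `lam` and death rates `mu n`, acting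
on functions. -/
noncomputable def gen (lam : ℝ) (mu : ℕ → ℝ) : (ℕ → ℝ) →ₗ[ℝ] (ℕ → ℝ) where
  toFun v n := lam * (v (n + 1) - v n) - mu n * (v n - v (n - 1))
  map_add' u v := by funext n; simp only [Pi.add_apply]; ring
  map_smul' a v := by funext n; simp only [Pi.smul_apply, smul_eq_mul, RingHom.id_apply]; ring

/-- The one-step operator of the birth-death process uniformized at rate `L`. -/
noncomputable def step (lam L : ℝ) (mu : ℕ → ℝ) : Module.End ℝ (ℕ → ℝ) :=
  1 + (1 / L) • gen lam mu

/-- The transition semigroup of the birth-death process uniformized at rate `L`, acting on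
functions. -/
noncomputable def semigroup (lam L : ℝ) (mu : ℕ → ℝ) (t : ℝ) (v : ℕ → ℝ) (n : ℕ) : ℝ :=
  poissonAvg (L * t) (fun j => (step lam L mu ^ j) v n)

/-- Boundedness at `n` of the iterates of the uniformized chain on `v`. It makes the series defining
`semigroup lam L mu t v n` converge, and allows to differentiate it in `t`. -/
def HasBoundedIterates (lam L : ℝ) (mu : ℕ → ℝ) (v : ℕ → ℝ) (n : ℕ) : Prop :=
  Memℓp (fun j => (step lam L mu ^ j) v n) ∞

/-- Rates of a birth-death process whose total rate out of any state is at most the uniformization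
rate `L`. -/
structure Rates (lam L : ℝ) (mu : ℕ → ℝ) : Prop where
  lam_pos : 0 < lam
  mu_nonneg : ∀ n, 0 ≤ mu n
  mu_zero : mu 0 = 0
  le_unif : ∀ n, lam + mu n ≤ L

variable {lam L t : ℝ} {mu u v : ℕ → ℝ} {n : ℕ}

theorem gen_apply (v : ℕ → ℝ) (n : ℕ) :
    gen lam mu v n = lam * (v (n + 1) - v n) - mu n * (v n - v (n - 1)) := rfl

theorem step_apply (v : ℕ → ℝ) (n : ℕ) :
    step lam L mu v n = v n + gen lam mu v n / L := by
  simp [step, div_eq_inv_mul]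

theorem step_pow_succ (v : ℕ → ℝ) (j : ℕ) :
    (step lam L mu ^ (j + 1)) v = step lam L mu ((step lam L mu ^ j) v) := by
  rw [pow_succ', Module.End.mul_apply]

theorem step_const (C : ℝ) : step lam L mu (fun _ => C) = fun _ => C := by
  funext n
  simp [step_apply, gen_apply]

theorem step_pow_const (C : ℝ) (j : ℕ) : (step lam L mu ^ j) (fun _ => C) = fun _ => C := by
  induction j with
  | zero => rfl
  | succ j ih => rw [step_pow_succ, ih, step_const]

theorem gen_step_pow (hL : L ≠ 0) (v : ℕ → ℝ) (j n : ℕ) :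
    gen lam mu ((step lam L mu ^ j) v) n
      = L * ((step lam L mu ^ (j + 1)) v n - (step lam L mu ^ j) v n) := by
  rw [step_pow_succ, step_apply, add_sub_cancel_left, mul_div_cancel₀ _ hL]

theorem step_pow_gen (v : ℕ → ℝ) (j : ℕ) :
    (step lam L mu ^ j) (gen lam mu v) = gen lam mu ((step lam L mu ^ j) v) := by
  have h : Commute (step lam L mu) (gen lam mu) :=
    (Commute.one_left _).add_left ((Commute.refl (gen lam mu)).smul_left (1 / L))
  exact LinearMap.congr_fun (h.pow_left j) v

theorem semigroup_zero (v : ℕ → ℝ) (n : ℕ) : semigroup lam L mu 0 v n = v n := by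
  simp [semigroup, poissonAvg_zero_left]

theorem semigroup_sub (hu : HasBoundedIterates lam L mu u n) (hv : HasBoundedIterates lam L mu v n)
    (t : ℝ) : semigroup lam L mu t (u - v) n
      = semigroup lam L mu t u n - semigroup lam L mu t v n := by
  simp only [semigroup, map_sub, Pi.sub_apply]
  exact poissonAvg_sub _ hu hv

theorem HasBoundedIterates.gen (hL : L ≠ 0) (hv : HasBoundedIterates lam L mu v n) :
    HasBoundedIterates lam L mu (gen lam mu v) n := by
  simp only [HasBoundedIterates, step_pow_gen, gen_step_pow hL]
  exact ((memℓp_infty_succ hv).sub hv).const_mul L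

theorem semigroup_gen (hL : L ≠ 0) (t : ℝ) (v : ℕ → ℝ) (n : ℕ) :
    semigroup lam L mu t (gen lam mu v) n = L * poissonAvg (L * t)
      (fun j => (step lam L mu ^ (j + 1)) v n - (step lam L mu ^ j) v n) := by
  simp only [semigroup, step_pow_gen, gen_step_pow hL, poissonAvg_const_mul]

theorem gen_semigroup (h₀ : mu n ≠ 0 → HasBoundedIterates lam L mu v (n - 1))
    (h₁ : HasBoundedIterates lam L mu v n) (h₂ : HasBoundedIterates lam L mu v (n + 1)) (t : ℝ) :
    gen lam mu (semigroup lam L mu t v) n = semigroup lam L mu t (gen lam mu v) n := by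
  simp only [semigroup, step_pow_gen, gen_apply]
  by_cases hmu : mu n = 0
  · simp only [hmu, zero_mul, sub_zero, poissonAvg_const_mul]
    rw [poissonAvg_sub _ h₂ h₁]
  · rw [← poissonAvg_sub _ h₂ h₁, ← poissonAvg_sub _ h₁ (h₀ hmu), ← poissonAvg_const_mul,
      ← poissonAvg_const_mul]
    exact (poissonAvg_sub _ ((h₂.sub h₁).const_mul lam) ((h₁.sub (h₀ hmu)).const_mul (mu n))).symm

theorem hasDerivAt_semigroup (hL : L ≠ 0) (hv : HasBoundedIterates lam L mu v n) (t : ℝ) :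
    HasDerivAt (fun s => semigroup lam L mu s v n) (semigroup lam L mu t (gen lam mu v) n) t := by
  have inner : HasDerivAt (fun s : ℝ => L * s) L t := by simpa using (hasDerivAt_id t).const_mul L
  rw [semigroup_gen hL, mul_comm]
  exact (hasDerivAt_poissonAvg hv (L * t)).comp t inner

theorem continuous_semigroup (hL : L ≠ 0) (hv : HasBoundedIterates lam L mu v n) :
    Continuous fun t => semigroup lam L mu t v n :=
  continuous_iff_continuousAt.2 fun t => (hasDerivAt_semigroup hL hv t).continuousAt

theorem integral_semigroup_gen (hL : L ≠ 0) (hv : HasBoundedIterates lam L mu v n) (T : ℝ) :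
    ∫ t in (0 : ℝ)..T, semigroup lam L mu t (gen lam mu v) n
      = semigroup lam L mu T v n - v n := by
  rw [intervalIntegral.integral_eq_sub_of_hasDerivAt
    (fun t _ => hasDerivAt_semigroup hL hv t)
    ((continuous_semigroup hL (hv.gen hL)).intervalIntegrable 0 T), semigroup_zero]

theorem tendsto_semigroup_gen (hL : 0 < L) (hv : HasBoundedIterates lam L mu v n) :
    Tendsto (fun t => semigroup lam L mu t (gen lam mu v) n) atTop (𝓝 0) := by
  simp only [semigroup_gen hL.ne']
  simpa using ((tendsto_poissonAvg_diff hv).comp (tendsto_id.const_mul_atTop hL)).const_mul L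

namespace Rates

variable (hR : Rates lam L mu)
include hR

theorem unif_pos : 0 < L := by
  linarith [hR.le_unif 0, hR.mu_zero, hR.lam_pos]

theorem step_nonneg (hv : ∀ n, 0 ≤ v n) (n : ℕ) : 0 ≤ step lam L mu v n := by
  have hL := hR.unif_pos
  have convex_combination : step lam L mu v n
      = ((L - lam - mu n) * v n + lam * v (n + 1) + mu n * v (n - 1)) / L := by
    rw [step_apply, gen_apply]
    field_simp
    ring
  have stay : 0 ≤ (L - lam - mu n) * v n := mul_nonneg (by linarith [hR.le_unif n]) (hv n)
  have up := mul_nonneg hR.lam_pos.le (hv (n + 1))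
  have down := mul_nonneg (hR.mu_nonneg n) (hv (n - 1))
  rw [convex_combination]
  positivity

theorem step_pow_nonneg (hv : ∀ n, 0 ≤ v n) (j n : ℕ) : 0 ≤ (step lam L mu ^ j) v n := by
  induction j generalizing n with
  | zero => exact hv n
  | succ j ih => rw [step_pow_succ]; exact hR.step_nonneg ih n

theorem step_pow_mono (huv : ∀ n, u n ≤ v n) (j n : ℕ) :
    (step lam L mu ^ j) u n ≤ (step lam L mu ^ j) v n := by
  have h := hR.step_pow_nonneg (v := v - u) (fun n => sub_nonneg.2 (huv n)) j n
  rwa [map_sub, Pi.sub_apply, sub_nonneg] at h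

theorem abs_step_pow_le (huv : ∀ n, |u n| ≤ v n) (j n : ℕ) :
    |(step lam L mu ^ j) u n| ≤ (step lam L mu ^ j) v n := by
  refine abs_le.2 ⟨?_, hR.step_pow_mono (fun n => (abs_le.1 (huv n)).2) j n⟩
  have h := hR.step_pow_mono (u := -v) (v := u) (fun n => (abs_le.1 (huv n)).1) j n
  rwa [map_neg, Pi.neg_apply] at h

theorem abs_step_pow_le_of_bounded {C : ℝ} (hv : ∀ n, |v n| ≤ C) (j n : ℕ) :
    |(step lam L mu ^ j) v n| ≤ C := by
  simpa only [step_pow_const] using hR.abs_step_pow_le hv j n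

theorem hasBoundedIterates_of_bounded {C : ℝ} (hv : ∀ n, |v n| ≤ C) (n : ℕ) :
    HasBoundedIterates lam L mu v n :=
  memℓp_infty_of_abs_le fun j => hR.abs_step_pow_le_of_bounded hv j n

theorem abs_semigroup_le {C : ℝ} (hC : ∀ j, |(step lam L mu ^ j) v n| ≤ C) (ht : 0 ≤ t) :
    |semigroup lam L mu t v n| ≤ C :=
  abs_poissonAvg_le (mul_nonneg hR.unif_pos.le ht) hC

end Rates

end Semigroup

/-! ### Reversible weights and convergence to equilibrium -/

/-- Summable reversible weights of the birth-death process, unnormalized, with support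
`{b, b + 1, …}`. -/
structure IsWeight (lam : ℝ) (mu : ℕ → ℝ) (b : ℕ) (w : ℕ → ℝ) : Prop where
  pos : ∀ n, b ≤ n → 0 < w n
  zero : ∀ n, n < b → w n = 0
  balance : ∀ n, lam * w n = mu (n + 1) * w (n + 1)
  summable : Summable w

namespace IsWeight

variable {lam L : ℝ} {mu v w : ℕ → ℝ} {b n : ℕ} (hw : IsWeight lam mu b w)
include hw

theorem nonneg (n : ℕ) : 0 ≤ w n := by
  rcases lt_or_ge n b with h | h
  · rw [hw.zero n h]
  · exact (hw.pos n h).le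

theorem tsum_pos : 0 < ∑' n, w n :=
  hw.summable.tsum_pos hw.nonneg b (hw.pos b le_rfl)

theorem summable_mul_abs (hv : Summable fun n => w n * v n) : Summable fun n => w n * |v n| :=
  hv.abs.congr fun n => by rw [abs_mul, abs_of_nonneg (hw.nonneg n)]

theorem hasSum_mul_of_hasSum_mul_sub {η s : ℝ} (hs : HasSum (fun n => w n * (v n - η)) s) :
    HasSum (fun n => w n * v n) ((η + s / ∑' n, w n) * ∑' n, w n) := by
  have h := hs.add (hw.summable.hasSum.mul_right η)
  rw [add_mul, div_mul_cancel₀ _ hw.tsum_pos.ne', add_comm, mul_comm η]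
  exact h.congr_fun fun n => by ring

theorem mu_pos (hlam : 0 < lam) (hn : b < n) : 0 < mu n := by
  obtain ⟨n, rfl⟩ := Nat.exists_eq_add_one_of_ne_zero (Nat.ne_zero_of_lt hn)
  refine pos_of_mul_pos_left ?_ (hw.nonneg (n + 1))
  rw [← hw.balance]
  exact mul_pos hlam (hw.pos n (Nat.le_of_lt_succ hn))

theorem hasSum_mul_mu (h0 : mu 0 = 0) : HasSum (fun n => w n * mu n) (lam * ∑' n, w n) := by
  rw [← hasSum_nat_add_iff' 1]
  simpa [h0, mul_comm (w _), ← hw.balance] using hw.summable.hasSum.mul_left lam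

variable (hR : Rates lam L mu)
include hR

theorem mu_bottom : mu b = 0 := by
  rcases b with _ | b
  · exact hR.mu_zero
  · have h := hw.balance b
    rw [hw.zero b b.lt_succ_self, mul_zero, zero_eq_mul] at h
    exact h.resolve_right (hw.pos _ le_rfl).ne'

theorem summable_mul_succ (hv : Summable fun n => w n * v n) :
    Summable fun n => lam * (w n * v (n + 1)) := by
  refine (((summable_nat_add_iff 1).2 hv).norm.mul_left L).of_norm_bounded fun n => ?_
  rw [← mul_assoc, hw.balance, mul_assoc, norm_mul, Real.norm_of_nonneg (hR.mu_nonneg _)]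
  exact mul_le_mul_of_nonneg_right (by linarith [hR.le_unif (n + 1), hR.lam_pos]) (norm_nonneg _)

-- By detailed balance, the flow from `n` to `n + 1` cancels against the reverse flow.
theorem hasSum_mul_gen (hv : Summable fun n => w n * v n) :
    HasSum (fun n => w n * gen lam mu v n) 0 := by
  have hup : Summable fun n => lam * w n * (v (n + 1) - v n) :=
    ((hw.summable_mul_succ hR hv).sub (hv.mul_left lam)).congr fun n => by ring
  have hdown : HasSum (fun n => mu n * w n * (v n - v (n - 1)))
      (∑' n, lam * w n * (v (n + 1) - v n)) := by
    have h := (hasSum_nat_add_iff (f := fun n => mu n * w n * (v n - v (n - 1))) 1).1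
      (hup.hasSum.congr_fun fun n => by simp only [Nat.add_sub_cancel, hw.balance])
    simpa [hR.mu_zero] using h
  refine (sub_self (∑' n, lam * w n * (v (n + 1) - v n)) ▸ hup.hasSum.sub hdown).congr_fun
    fun n => ?_
  rw [gen_apply]
  ring

theorem hasSum_mul_step_pow {s : ℝ} (hv : HasSum (fun n => w n * v n) s) (j : ℕ) :
    HasSum (fun n => w n * (step lam L mu ^ j) v n) s := by
  induction j with
  | zero => exact hv
  | succ j ih =>
    have h := ih.add ((hw.hasSum_mul_gen hR ih.summable).div_const L)
    rw [zero_div, add_zero] at h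
    refine h.congr_fun fun n => ?_
    rw [step_pow_succ, step_apply]
    ring

theorem abs_step_pow_le_div (hv : Summable fun n => w n * v n) (hn : b ≤ n) (j : ℕ) :
    |(step lam L mu ^ j) v n| ≤ (∑' m, w m * |v m|) / w n := by
  refine (hR.abs_step_pow_le (v := fun n => |v n|) (fun _ => le_rfl) j n).trans ?_
  rw [le_div_iff₀' (hw.pos n hn)]
  exact le_hasSum (hw.hasSum_mul_step_pow hR (hw.summable_mul_abs hv).hasSum j) n
    fun m _ => mul_nonneg (hw.nonneg m) (hR.step_pow_nonneg (fun _ => abs_nonneg _) j m)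

theorem hasBoundedIterates (hv : Summable fun n => w n * v n) (hn : b ≤ n) :
    HasBoundedIterates lam L mu v n :=
  memℓp_infty_of_abs_le (hw.abs_step_pow_le_div hR hv hn)

theorem gen_semigroup (hv : Summable fun n => w n * v n) (hn : b ≤ n) (t : ℝ) :
    gen lam mu (semigroup lam L mu t v) n = semigroup lam L mu t (gen lam mu v) n := by
  refine BirthDeath.gen_semigroup (fun hmu => ?_) (hw.hasBoundedIterates hR hv hn)
    (hw.hasBoundedIterates hR hv (hn.trans n.le_succ)) t
  have hne : b ≠ n := fun h => hmu (h ▸ hw.mu_bottom hR)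
  exact hw.hasBoundedIterates hR hv (Nat.le_sub_one_of_lt (hn.lt_of_ne hne))

theorem tendsto_semigroup_succ_sub (hv : Summable fun n => w n * v n) (hn : b ≤ n) :
    Tendsto (fun t => semigroup lam L mu t v (n + 1) - semigroup lam L mu t v n)
      atTop (𝓝 0) := by
  have hgen (m : ℕ) (hm : b ≤ m) :
      Tendsto (fun t => gen lam mu (semigroup lam L mu t v) m) atTop (𝓝 0) := by
    simp only [hw.gen_semigroup hR hv hm]
    exact tendsto_semigroup_gen hR.unif_pos (hw.hasBoundedIterates hR hv hm)
  have hlam := hR.lam_pos.ne'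
  induction n, hn using Nat.le_induction with
  | base =>
    refine (zero_div lam ▸ (hgen b le_rfl).div_const lam).congr fun t => ?_
    rw [gen_apply, hw.mu_bottom hR]
    field_simp
    ring
  | succ m hm ih =>
    have h := ((hgen (m + 1) (hm.trans m.le_succ)).add (ih.const_mul (mu (m + 1)))).div_const lam
    rw [mul_zero, add_zero, zero_div] at h
    refine h.congr fun t => ?_
    rw [gen_apply, Nat.add_sub_cancel]
    field_simp
    ring

theorem tendsto_semigroup_sub {m : ℕ} (hv : Summable fun n => w n * v n) (hm : b ≤ m)
    (hn : b ≤ n) :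
    Tendsto (fun t => semigroup lam L mu t v n - semigroup lam L mu t v m) atTop (𝓝 0) := by
  have from_bottom (m : ℕ) (hm : b ≤ m) :
      Tendsto (fun t => semigroup lam L mu t v m - semigroup lam L mu t v b) atTop (𝓝 0) := by
    induction m, hm using Nat.le_induction with
    | base => simp
    | succ m hm ih =>
      simpa only [sub_add_sub_cancel, add_zero] using
        (hw.tendsto_semigroup_succ_sub hR hv hm).add ih
  simpa only [sub_sub_sub_cancel_right, sub_zero] using (from_bottom n hn).sub (from_bottom m hm)

theorem hasSum_mul_semigroup {C s t : ℝ} (hC : ∀ n, |v n| ≤ C)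
    (hv : HasSum (fun n => w n * v n) s) (ht : 0 ≤ t) :
    HasSum (fun n => w n * semigroup lam L mu t v n) s := by
  have hr : 0 ≤ L * t := mul_nonneg hR.unif_pos.le ht
  let F (j n : ℕ) : ℝ := poissonWeight (L * t) j * (w n * (step lam L mu ^ j) v n)
  have hF : Summable (Function.uncurry F) := by
    refine (((hasSum_poissonWeight (L * t)).summable.mul_of_nonneg hw.summable
      (poissonWeight_nonneg hr) hw.nonneg).mul_right C).of_norm_bounded fun p => ?_
    have hj := poissonWeight_nonneg hr p.1
    have hn := hw.nonneg p.2
    rw [Function.uncurry, norm_mul, norm_mul, Real.norm_of_nonneg hj, Real.norm_of_nonneg hn,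
      mul_assoc]
    gcongr
    exact hR.abs_step_pow_le_of_bounded hC p.1 p.2
  have sum_left (n : ℕ) : ∑' j, F j n = w n * semigroup lam L mu t v n := by
    rw [semigroup, poissonAvg, ← tsum_mul_left]
    exact tsum_congr fun j => mul_left_comm _ _ _
  have sum_right (j : ℕ) : ∑' n, F j n = poissonWeight (L * t) j * s :=
    ((hw.hasSum_mul_step_pow hR hv j).mul_left _).tsum_eq
  have total : ∑' n, w n * semigroup lam L mu t v n = s := by
    simp only [← sum_left]
    rw [hF.tsum_comm]
    simp only [sum_right, tsum_mul_right, (hasSum_poissonWeight _).tsum_eq, one_mul]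
  rw [← total]
  exact (hF.prod_symm.prod.congr sum_left).hasSum

theorem tendsto_semigroup_of_bounded {C s : ℝ} (hC : ∀ n, |v n| ≤ C)
    (hv : HasSum (fun n => w n * v n) s) (hn : b ≤ n) :
    Tendsto (fun t => semigroup lam L mu t v n) atTop (𝓝 (s / ∑' n, w n)) := by
  have hbound {t : ℝ} (ht : 0 ≤ t) (m : ℕ) : |semigroup lam L mu t v m| ≤ C :=
    hR.abs_semigroup_le (fun j => hR.abs_step_pow_le_of_bounded hC j m) ht
  have hlim : Tendsto
      (fun t => ∑' m, w m * (semigroup lam L mu t v n - semigroup lam L mu t v m))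
      atTop (𝓝 (∑' _ : ℕ, 0)) := by
    refine tendsto_tsum_of_dominated_convergence (hw.summable.mul_right (C + C)) (fun m => ?_) ?_
    · rcases lt_or_ge m b with h | h
      · simp [hw.zero m h]
      · simpa using (hw.tendsto_semigroup_sub hR hv.summable h hn).const_mul (w m)
    · filter_upwards [eventually_ge_atTop 0] with t ht m
      rw [norm_mul, Real.norm_of_nonneg (hw.nonneg m)]
      exact mul_le_mul_of_nonneg_left
        ((norm_sub_le _ _).trans (add_le_add (hbound ht n) (hbound ht m))) (hw.nonneg m)
  rw [tsum_zero] at hlim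
  have h := (hlim.add_const s).div_const (∑' n, w n)
  rw [zero_add] at h
  refine h.congr' ?_
  filter_upwards [eventually_ge_atTop 0] with t ht
  have hsum := (hw.summable.hasSum.mul_right (semigroup lam L mu t v n)).sub
    (hw.hasSum_mul_semigroup hR hC hv ht)
  simp only [mul_sub, hsum.tsum_eq, sub_add_cancel]
  exact mul_div_cancel_left₀ _ hw.tsum_pos.ne'

omit hR in
theorem tendsto_tsum_mul_abs_indicator_sub (hv : Summable fun n => w n * v n) :
    Tendsto (fun N => ∑' m, w m * |((Set.Iio N).indicator v - v) m|) atTop (𝓝 0) := by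
  rw [← tsum_zero (α := ℝ) (β := ℕ)]
  refine tendsto_tsum_of_dominated_convergence (hw.summable_mul_abs hv)
    (fun m => tendsto_const_nhds.congr' ?_) (Eventually.of_forall fun N m => ?_)
  · filter_upwards [eventually_gt_atTop m] with N hN
    simp [hN]
  · rw [norm_mul, Real.norm_of_nonneg (hw.nonneg m), Real.norm_eq_abs, abs_abs, Pi.sub_apply]
    refine mul_le_mul_of_nonneg_left ?_ (hw.nonneg m)
    by_cases hm : m ∈ Set.Iio N <;> simp [hm]

-- Bounded functions are dense in the functions summable against `w`, and the semigroup is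
-- continuous in the weighted norm, uniformly in time.
theorem tendsto_semigroup {s : ℝ} (hv : HasSum (fun n => w n * v n) s) (hn : b ≤ n) :
    Tendsto (fun t => semigroup lam L mu t v n) atTop (𝓝 (s / ∑' n, w n)) := by
  let u (N : ℕ) : ℕ → ℝ := (Set.Iio N).indicator v
  have hwu (N : ℕ) : HasSum (fun m => w m * u N m) (∑ m ∈ Finset.range N, w m * v m) := by
    rw [Finset.sum_congr rfl fun m hm => by
      rw [← Set.indicator_of_mem (Set.mem_Iio.2 (Finset.mem_range.1 hm)) v]]
    exact hasSum_sum_of_ne_finset_zero fun m hm => by simp_all [u]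
  have hu_bounded (N m : ℕ) : |u N m| ≤ ∑ i ∈ Finset.range N, |v i| := by
    by_cases hm : m ∈ Set.Iio N
    · simpa only [u, Set.indicator_of_mem hm] using
        Finset.single_le_sum (f := fun i => |v i|) (fun i _ => abs_nonneg _) (Finset.mem_range.2 hm)
    · simpa only [u, Set.indicator_of_notMem hm, abs_zero] using
        Finset.sum_nonneg fun i _ => abs_nonneg (v i)
  have htail := (hw.tendsto_tsum_mul_abs_indicator_sub hv.summable).div_const (w n)
  rw [zero_div] at htail
  have hunif : TendstoUniformlyOnFilter (fun N t => semigroup lam L mu t (u N) n)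
      (fun t => semigroup lam L mu t v n) atTop atTop := by
    rw [Metric.tendstoUniformlyOnFilter_iff]
    intro ε hε
    filter_upwards [(htail.eventually (gt_mem_nhds hε)).prod_mk (eventually_ge_atTop (0 : ℝ))]
      with p ⟨hN, ht⟩
    have hdiff : Summable fun m => w m * (u p.1 - v) m := by
      simpa only [Pi.sub_apply, mul_sub] using (hwu p.1).summable.sub hv.summable
    rw [dist_comm, Real.dist_eq, ← semigroup_sub (hw.hasBoundedIterates hR (hwu p.1).summable hn)
      (hw.hasBoundedIterates hR hv.summable hn)]
    exact (hR.abs_semigroup_le (hw.abs_step_pow_le_div hR hdiff hn) ht).trans_lt hN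
  exact hunif.tendsto_of_eventually_tendsto
    (Eventually.of_forall fun N => hw.tendsto_semigroup_of_bounded hR (hu_bounded N) (hwu N) hn)
    (hv.tendsto_sum_nat.div_const _)

end IsWeight

end BirthDeath

/-! ### The queue as a birth-death process -/

namespace GroupServerQueue

open BirthDeath

variable {K : ℕ} {Q : GroupServerQueue K} {d : ℕ → Fin K → ℕ}

/-- The total service rate under the policy `d`, as a function of the state: the death rates of the
queue. -/
noncomputable abbrev deathRate (Q : GroupServerQueue K) (d : ℕ → Fin K → ℕ) (n : ℕ) : ℝ :=
  Q.serviceRate (d n)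

/-- The cost rate under the policy `d`, as a function of the state. -/
noncomputable abbrev runningCost (Q : GroupServerQueue K) (d : ℕ → Fin K → ℕ) (n : ℕ) : ℝ :=
  Q.costRate n (d n)

/-- The uniformized transition matrix of the queue under `d`, acting on functions. -/
noncomputable abbrev jumpOp (Q : GroupServerQueue K) (d : ℕ → Fin K → ℕ) :
    Module.End ℝ (ℕ → ℝ) :=
  step Q.lam Q.unifRate (Q.deathRate d)

/-- The transition function of the queue under `d`, acting on functions. -/
noncomputable abbrev transOp (Q : GroupServerQueue K) (d : ℕ → Fin K → ℕ) (t : ℝ) (v : ℕ → ℝ)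
    (n : ℕ) : ℝ :=
  semigroup Q.lam Q.unifRate (Q.deathRate d) t v n

theorem IsEfficient.apply_zero (hd : Q.IsEfficient d) (k : Fin K) : d 0 k = 0 :=
  Finset.sum_eq_zero_iff.1 (Nat.le_zero.1 (hd 0).2) k (Finset.mem_univ k)

theorem serviceRate_nonneg (hmu : ∀ k, 0 < Q.mu k) (m : Fin K → ℕ) : 0 ≤ Q.serviceRate m :=
  Finset.sum_nonneg fun k _ => mul_nonneg (Nat.cast_nonneg _) (hmu k).le

theorem serviceRate_eq_zero_iff (hmu : ∀ k, 0 < Q.mu k) (m : Fin K → ℕ) :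
    Q.serviceRate m = 0 ↔ ∀ k, m k = 0 := by
  rw [serviceRate,
    Finset.sum_eq_zero_iff_of_nonneg fun k _ => mul_nonneg (Nat.cast_nonneg _) (hmu k).le]
  simp [(hmu _).ne']

theorem IsEfficient.rates (hd : Q.IsEfficient d) (hlam : 0 < Q.lam) (hmu : ∀ k, 0 < Q.mu k) :
    Rates Q.lam Q.unifRate (Q.deathRate d) where
  lam_pos := hlam
  mu_nonneg n := serviceRate_nonneg hmu _
  mu_zero := (serviceRate_eq_zero_iff hmu _).2 hd.apply_zero
  le_unif n := by
    unfold unifRate deathRate serviceRate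
    gcongr with k
    · exact (hmu k).le
    · exact (hd n).1 k

theorem sum_jump_mul (hz : Q.serviceRate (d 0) = 0) (v : ℕ → ℝ) (n : ℕ) :
    ∑ l ∈ Finset.range (n + 2), Q.jump d n l * v l = Q.jumpOp d v n := by
  rw [step_apply, gen_apply]
  rcases n with _ | n
  · simp [Finset.sum_range_succ, jump, generator, hz]
    ring
  · rw [Finset.sum_range_succ, Finset.sum_range_succ, Finset.sum_range_succ, Finset.sum_eq_zero]
    · have h0 : n ≠ n + 1 + 1 := by omega
      simp [jump, generator, h0]
      ring
    · intro l hl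
      have hl := Finset.mem_range.1 hl
      have h1 : l ≠ n + 1 := by omega
      have h2 : l ≠ n + 1 + 1 := by omega
      have h3 : n ≠ l := by omega
      simp [jump, generator, h1, h2, h3]

theorem hasSum_jumpPow_mul (hz : Q.serviceRate (d 0) = 0) (v : ℕ → ℝ) (j n : ℕ) :
    HasSum (fun m => Q.jumpPow d j n m * v m) ((Q.jumpOp d ^ j) v n) := by
  induction j generalizing n with
  | zero =>
    have h := hasSum_single (f := fun m => Q.jumpPow d 0 n m * v m) n fun m hm => by
      simp [jumpPow, hm]
    simpa [jumpPow] using h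
  | succ j ih =>
    rw [step_pow_succ, ← sum_jump_mul hz]
    have h := hasSum_sum (s := Finset.range (n + 2)) fun l _ => (ih l).mul_left (Q.jump d n l)
    refine h.congr_fun fun m => ?_
    simp only [jumpPow, Finset.sum_mul, mul_assoc]

theorem jumpPow_eq (hz : Q.serviceRate (d 0) = 0) (j n m : ℕ) :
    Q.jumpPow d j n m = (Q.jumpOp d ^ j) (Pi.single m 1) n := by
  rw [← (hasSum_jumpPow_mul hz (Pi.single m 1) j n).tsum_eq,
    tsum_eq_single m fun l hl => by simp [hl], Pi.single_eq_same, mul_one]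

theorem abs_single_le_one (m l : ℕ) : |(Pi.single m 1 : ℕ → ℝ) l| ≤ 1 := by
  rw [Pi.single_apply]
  split_ifs <;> simp

section Rates

variable (hR : Rates Q.lam Q.unifRate (Q.deathRate d))
include hR

theorem jumpPow_nonneg (j n m : ℕ) : 0 ≤ Q.jumpPow d j n m := by
  rw [jumpPow_eq hR.mu_zero]
  exact hR.step_pow_nonneg (fun l => by rw [Pi.single_apply]; split_ifs <;> simp) j n

theorem trans_eq (t : ℝ) (n m : ℕ) : Q.trans d t n m = Q.transOp d t (Pi.single m 1) n := by
  simp only [trans, semigroup, poissonAvg, poissonWeight, jumpPow_eq hR.mu_zero]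

theorem trans_nonneg {t : ℝ} (ht : 0 ≤ t) (n m : ℕ) : 0 ≤ Q.trans d t n m :=
  tsum_nonneg fun j => mul_nonneg (poissonWeight_nonneg (mul_nonneg hR.unif_pos.le ht) j)
    (jumpPow_nonneg hR j n m)

theorem continuous_trans (n m : ℕ) : Continuous fun t => Q.trans d t n m := by
  simp only [trans_eq hR]
  exact continuous_semigroup hR.unif_pos.ne'
    (hR.hasBoundedIterates_of_bounded (abs_single_le_one m) n)

theorem intervalIntegrable_sum_mul_trans (s : Finset ℕ) (a : ℕ → ℝ) (n : ℕ) (T : ℝ) :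
    IntervalIntegrable (fun t => ∑ m ∈ s, a m * Q.trans d t n m) volume 0 T :=
  (continuous_finsetSum s fun m _ =>
    (continuous_trans hR n m).const_mul (a m)).intervalIntegrable 0 T

variable {v : ℕ → ℝ} {t : ℝ} {n : ℕ}

theorem summable_poissonWeight_mul_jumpPow_mul
    (hv : HasBoundedIterates Q.lam Q.unifRate (Q.deathRate d) (fun m => |v m|) n) (ht : 0 ≤ t) :
    Summable fun p : ℕ × ℕ =>
      poissonWeight (Q.unifRate * t) p.1 * (Q.jumpPow d p.1 n p.2 * v p.2) := by
  have hweight (j : ℕ) := poissonWeight_nonneg (mul_nonneg hR.unif_pos.le ht) j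
  have row (j : ℕ) := hasSum_jumpPow_mul hR.mu_zero (fun m => |v m|) j n
  have term_nonneg (p : ℕ × ℕ) :
      0 ≤ poissonWeight (Q.unifRate * t) p.1 * (Q.jumpPow d p.1 n p.2 * |v p.2|) :=
    mul_nonneg (hweight _) (mul_nonneg (jumpPow_nonneg hR _ _ _) (abs_nonneg _))
  have habs : Summable fun p : ℕ × ℕ =>
      poissonWeight (Q.unifRate * t) p.1 * (Q.jumpPow d p.1 n p.2 * |v p.2|) := by
    refine (summable_prod_of_nonneg term_nonneg).2
      ⟨fun j => (row j).summable.mul_left (poissonWeight (Q.unifRate * t) j), ?_⟩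
    simp only [tsum_mul_left, (row _).tsum_eq]
    exact summable_poissonWeight_mul _ hv
  refine Summable.of_norm (habs.congr fun p => ?_)
  rw [norm_mul, norm_mul, Real.norm_of_nonneg (hweight _),
    Real.norm_of_nonneg (jumpPow_nonneg hR _ _ _), Real.norm_eq_abs]

theorem hasSum_trans_mul
    (hv : HasBoundedIterates Q.lam Q.unifRate (Q.deathRate d) (fun m => |v m|) n) (ht : 0 ≤ t) :
    HasSum (fun m => Q.trans d t n m * v m) (Q.transOp d t v n) := by
  have hF := summable_poissonWeight_mul_jumpPow_mul hR hv ht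
  have sum_left (m : ℕ) :
      ∑' j, poissonWeight (Q.unifRate * t) j * (Q.jumpPow d j n m * v m)
        = Q.trans d t n m * v m := by
    simp only [trans, poissonWeight, ← tsum_mul_right, mul_assoc]
  have sum_right (j : ℕ) := (hasSum_jumpPow_mul hR.mu_zero v j n).tsum_eq
  have total : ∑' m, Q.trans d t n m * v m = Q.transOp d t v n := by
    simp only [← sum_left]
    rw [hF.tsum_comm]
    simp only [tsum_mul_left, sum_right, transOp, semigroup, poissonAvg]
  rw [← total]
  exact (hF.prod_symm.prod.congr sum_left).hasSum

theorem hasSum_trans (ht : 0 ≤ t) (n : ℕ) : HasSum (fun m => Q.trans d t n m) 1 := by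
  have h := hasSum_trans_mul hR (v := fun _ => 1)
    (hR.hasBoundedIterates_of_bounded (C := 1) (by simp) n) ht
  simpa only [mul_one, transOp, semigroup, step_pow_const, poissonAvg_const] using h

end Rates

/-! ### Long-run average cost -/

theorem tendsto_timeAverage {φ : ℝ → ℝ} {l C : ℝ} (hcont : ContinuousOn φ (Set.Ici 0))
    (hbound : ∀ t, 0 ≤ t → |φ t| ≤ C) (hlim : Tendsto φ atTop (𝓝 l)) :
    Tendsto (fun T : ℝ => 1 / T * ∫ t in (0 : ℝ)..T, φ t) atTop (𝓝 l) := by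
  have h : Tendsto (fun T : ℝ => ∫ s in (0 : ℝ)..1, φ (T * s)) atTop
      (𝓝 (∫ _ in (0 : ℝ)..1, l)) := by
    refine intervalIntegral.tendsto_integral_filter_of_dominated_convergence (fun _ => C)
      ?_ ?_ intervalIntegrable_const ?_ <;> rw [Set.uIoc_of_le zero_le_one]
    · filter_upwards [eventually_ge_atTop 0] with T hT
      exact (hcont.comp (by fun_prop) fun s hs =>
        mul_nonneg hT hs.1.le).aestronglyMeasurable measurableSet_Ioc
    · filter_upwards [eventually_ge_atTop 0] with T hT
      exact Eventually.of_forall fun s hs => hbound _ (mul_nonneg hT hs.1.le)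
    · exact Eventually.of_forall fun s hs => hlim.comp (tendsto_id.atTop_mul_const hs.1)
  rw [intervalIntegral.integral_const, sub_zero, one_smul] at h
  refine h.congr' ?_
  filter_upwards [eventually_gt_atTop 0] with T hT
  rw [intervalIntegral.integral_comp_mul_left _ hT.ne', mul_zero, mul_one, smul_eq_mul, one_div]

section Weight

variable {b n : ℕ} {w : ℕ → ℝ} (hR : Rates Q.lam Q.unifRate (Q.deathRate d))
  (hw : IsWeight Q.lam (Q.deathRate d) b w)
include hR hw

theorem hasSum_trans_mul_runningCost (hv : Summable fun n => w n * Q.runningCost d n)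
    (hn : b ≤ n) {t : ℝ} (ht : 0 ≤ t) :
    HasSum (fun m => Q.trans d t n m * Q.runningCost d m)
      (Q.transOp d t (Q.runningCost d) n) :=
  hasSum_trans_mul hR (hw.hasBoundedIterates hR (hw.summable_mul_abs hv) hn) ht

theorem meanCost_eq_transOp (hv : Summable fun n => w n * Q.runningCost d n) (hn : b ≤ n)
    {t : ℝ} (ht : 0 ≤ t) : Q.meanCost d t n = Q.transOp d t (Q.runningCost d) n :=
  (hasSum_trans_mul_runningCost hR hw hv hn ht).tsum_eq

theorem tendsto_meanCost {s : ℝ} (hs : HasSum (fun n => w n * Q.runningCost d n) s)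
    (hn : b ≤ n) : Tendsto (fun t => Q.meanCost d t n) atTop (𝓝 (s / ∑' n, w n)) := by
  refine (hw.tendsto_semigroup hR hs hn).congr' ?_
  filter_upwards [eventually_ge_atTop 0] with t ht
  exact (meanCost_eq_transOp hR hw hs.summable hn ht).symm

theorem continuousOn_meanCost (hv : Summable fun n => w n * Q.runningCost d n) (hn : b ≤ n) :
    ContinuousOn (fun t => Q.meanCost d t n) (Set.Ici 0) :=
  (continuous_semigroup hR.unif_pos.ne' (hw.hasBoundedIterates hR hv hn)).continuousOn.congr
    fun _ ht => meanCost_eq_transOp hR hw hv hn ht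

theorem hasAverageCost_of_hasSum {s : ℝ} (hs : HasSum (fun n => w n * Q.runningCost d n) s)
    (hn : b ≤ n) : Q.HasAverageCost d n (s / ∑' n, w n) := by
  have hcont := continuousOn_meanCost hR hw hs.summable hn
  refine ⟨fun t ht => (hasSum_trans_mul_runningCost hR hw hs.summable hn ht).summable,
    fun T hT => (hcont.mono ?_).intervalIntegrable,
    tendsto_timeAverage hcont (C := (∑' m, w m * |Q.runningCost d m|) / w n) (fun t ht => ?_)
      (tendsto_meanCost hR hw hs hn)⟩
  · rw [Set.uIcc_of_le hT]
    exact Set.Icc_subset_Ici_self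
  · rw [meanCost_eq_transOp hR hw hs.summable hn ht]
    exact hR.abs_semigroup_le (hw.abs_step_pow_le_div hR hs.summable hn) ht

theorem hasAverageCost_of_hasSum_excess {η s : ℝ}
    (hs : HasSum (fun n => w n * (Q.runningCost d n - η)) s) (hn : b ≤ n) :
    Q.HasAverageCost d n (η + s / ∑' n, w n) := by
  simpa only [mul_div_cancel_right₀ _ hw.tsum_pos.ne'] using
    hasAverageCost_of_hasSum hR hw (hw.hasSum_mul_of_hasSum_mul_sub hs) hn

theorem tendsto_meanCost_of_hasSum_excess {η s : ℝ}
    (hs : HasSum (fun n => w n * (Q.runningCost d n - η)) s) (hn : b ≤ n) :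
    Tendsto (fun t => Q.meanCost d t n) atTop (𝓝 (η + s / ∑' n, w n)) := by
  simpa only [mul_div_cancel_right₀ _ hw.tsum_pos.ne'] using
    tendsto_meanCost hR hw (hw.hasSum_mul_of_hasSum_mul_sub hs) hn

end Weight

theorem HasAverageCost.unique {n : ℕ} {η η' : ℝ} (h : Q.HasAverageCost d n η)
    (h' : Q.HasAverageCost d n η') : η = η' :=
  tendsto_nhds_unique h.2.2 h'.2.2

end GroupServerQueue

namespace BirthDeath

variable {lam : ℝ} {mu x : ℕ → ℝ}

theorem exists_isWeight_of_balance (hlam : 0 < lam) (hx : ∀ m, 0 ≤ x m) (hne : x ≠ 0)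
    (hbal : ∀ m, lam * x m = mu (m + 1) * x (m + 1)) (hsum : Summable x) :
    ∃ b, IsWeight lam mu b x := by
  classical
  have hex : ∃ m, x m ≠ 0 := Function.ne_iff.1 hne
  refine ⟨Nat.find hex, fun m hm => ?_, fun m hm => not_not.1 (Nat.find_min hex hm), hbal, hsum⟩
  induction m, hm using Nat.le_induction with
  | base => exact (hx _).lt_of_ne' (Nat.find_spec hex)
  | succ m _ ih =>
    refine (hx _).lt_of_ne' fun h => (mul_pos hlam ih).ne' ?_
    rw [hbal, h, mul_zero]

theorem gen_indicator_le (lam : ℝ) (mu : ℕ → ℝ) (N : ℕ) :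
    gen lam mu (fun l => if l ≤ N then 1 else 0)
      = mu (N + 1) • Pi.single (N + 1) 1 - lam • Pi.single N 1 := by
  funext l
  simp only [gen_apply, Pi.sub_apply, Pi.smul_apply, smul_eq_mul, Pi.single_apply]
  rcases lt_trichotomy l N with h | rfl | h
  · simp [h.le, Nat.succ_le_of_lt h, (Nat.sub_le l 1).trans h.le, h.ne, (h.trans N.lt_succ_self).ne]
  · simp
  · rcases (Nat.succ_le_of_lt h).eq_or_lt with rfl | h'
    · simp
    · have h₁ : ¬ l + 1 ≤ N := by omega
      have h₂ : ¬ l - 1 ≤ N := by omega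
      simp [h.not_ge, h₁, h₂, h.ne', h'.ne']

end BirthDeath

/-! ### Occupation measures -/

namespace GroupServerQueue

open BirthDeath

variable {K : ℕ} {Q : GroupServerQueue K} {d : ℕ → Fin K → ℕ}

/-- The expected fraction of the time up to `T` that the queue, started in `n`, spends in `m`. -/
noncomputable def occupation (Q : GroupServerQueue K) (d : ℕ → Fin K → ℕ) (n : ℕ) (T : ℝ)
    (m : ℕ) : ℝ :=
  1 / T * ∫ t in (0 : ℝ)..T, Q.trans d t n m

theorem le_costRate (hc : ∀ k, 0 ≤ Q.c k) (n : ℕ) (m : Fin K → ℕ) : Q.h n ≤ Q.costRate n m :=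
  le_add_of_nonneg_right (Finset.sum_nonneg fun k _ => mul_nonneg (Nat.cast_nonneg _) (hc k))

section Occupation

variable (hR : Rates Q.lam Q.unifRate (Q.deathRate d)) {n : ℕ} {η T : ℝ}
include hR

theorem occupation_nonneg (n m : ℕ) (hT : 0 ≤ T) : 0 ≤ Q.occupation d n T m :=
  mul_nonneg (one_div_nonneg.2 hT)
    (intervalIntegral.integral_nonneg hT fun _ ht => trans_nonneg hR ht.1 n m)

theorem sum_mul_occupation (n : ℕ) (T : ℝ) (s : Finset ℕ) (a : ℕ → ℝ) :
    ∑ m ∈ s, a m * Q.occupation d n T m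
      = 1 / T * ∫ t in (0 : ℝ)..T, ∑ m ∈ s, a m * Q.trans d t n m := by
  rw [intervalIntegral.integral_finsetSum fun m _ =>
    ((continuous_trans hR n m).const_mul (a m)).intervalIntegrable 0 T, Finset.mul_sum]
  simp only [intervalIntegral.integral_const_mul, occupation, mul_left_comm]

theorem sum_occupation_le_one (n : ℕ) (hT : 0 < T) (s : Finset ℕ) :
    ∑ m ∈ s, Q.occupation d n T m ≤ 1 := by
  have h := sum_mul_occupation hR n T s fun _ => 1
  have hint := intervalIntegrable_sum_mul_trans hR s (fun _ => 1) n T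
  simp only [one_mul] at h hint
  rw [h, one_div, inv_mul_le_one₀ hT]
  simpa using intervalIntegral.integral_mono_on hT.le hint intervalIntegrable_const
    (g := fun _ => (1 : ℝ)) fun t ht =>
      sum_le_hasSum s (fun m _ => trans_nonneg hR ht.1 n m) (hasSum_trans hR ht.1 n)

theorem occupation_mem_Icc (n m : ℕ) (hT : 0 < T) : Q.occupation d n T m ∈ Set.Icc (0 : ℝ) 1 :=
  ⟨occupation_nonneg hR n m hT.le, by simpa using sum_occupation_le_one hR n hT {m}⟩

theorem transOp_gen_indicator_le (t : ℝ) (n N : ℕ) :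
    Q.transOp d t (gen Q.lam (Q.deathRate d) fun l => if l ≤ N then 1 else 0) n
      = Q.deathRate d (N + 1) * Q.trans d t n (N + 1) - Q.lam * Q.trans d t n N := by
  have hsingle (m : ℕ) := hR.hasBoundedIterates_of_bounded (abs_single_le_one m) n
  rw [gen_indicator_le, trans_eq hR, trans_eq hR]
  simp only [transOp, semigroup, map_sub, map_smul, Pi.sub_apply, Pi.smul_apply, smul_eq_mul]
  rw [poissonAvg_sub _ ((hsingle _).const_mul _) ((hsingle _).const_mul _), poissonAvg_const_mul,
    poissonAvg_const_mul]

theorem balance_occupation (n N : ℕ) (T : ℝ) :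
    Q.deathRate d (N + 1) * Q.occupation d n T (N + 1) - Q.lam * Q.occupation d n T N
      = 1 / T * (Q.transOp d T (fun l => if l ≤ N then 1 else 0) n - if n ≤ N then 1 else 0) := by
  have hind (l : ℕ) : |(if l ≤ N then 1 else 0 : ℝ)| ≤ 1 := by split_ifs <;> simp
  have hint (m : ℕ) (a : ℝ) : IntervalIntegrable (fun t => a * Q.trans d t n m) volume 0 T :=
    ((continuous_trans hR n m).const_mul a).intervalIntegrable 0 T
  have dynkin := integral_semigroup_gen hR.unif_pos.ne' (hR.hasBoundedIterates_of_bounded hind n) T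
  simp only [transOp_gen_indicator_le hR] at dynkin
  rw [← dynkin, intervalIntegral.integral_sub (hint _ _) (hint _ _),
    intervalIntegral.integral_const_mul, intervalIntegral.integral_const_mul, occupation,
    occupation]
  ring

theorem abs_balance_occupation_le (n N : ℕ) (hT : 0 < T) :
    |Q.deathRate d (N + 1) * Q.occupation d n T (N + 1) - Q.lam * Q.occupation d n T N|
      ≤ 2 / T := by
  have hind (l : ℕ) : |(if l ≤ N then 1 else 0 : ℝ)| ≤ 1 := by split_ifs <;> simp
  have hsemi := hR.abs_semigroup_le (fun j => hR.abs_step_pow_le_of_bounded hind j n) hT.le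
  rw [balance_occupation hR, abs_mul, abs_of_pos (one_div_pos.2 hT), one_div,
    inv_mul_le_iff₀ hT, mul_div_cancel₀ _ hT.ne']
  exact (abs_sub _ _).trans ((add_le_add hsemi (hind n)).trans_eq one_add_one_eq_two)

variable (hη : Q.HasAverageCost d n η)

include hη in
theorem add_sum_mul_occupation_le {s : Finset ℕ} {C : ℝ} {u : ℕ → ℝ}
    (hu : ∀ m, C + (if m ∈ s then u m else 0) ≤ Q.runningCost d m) (hT : 0 < T) :
    C + ∑ m ∈ s, u m * Q.occupation d n T m
      ≤ 1 / T * ∫ t in (0 : ℝ)..T, Q.meanCost d t n := by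
  have pointwise {t : ℝ} (ht : 0 ≤ t) :
      C + ∑ m ∈ s, u m * Q.trans d t n m ≤ Q.meanCost d t n := by
    have hs : HasSum (fun m => Q.trans d t n m * if m ∈ s then u m else 0)
        (∑ m ∈ s, u m * Q.trans d t n m) := by
      rw [Finset.sum_congr rfl fun m hm => by rw [mul_comm, ← if_pos (t := u m) (e := 0) hm]]
      exact hasSum_sum_of_ne_finset_zero fun m hm => by simp [hm]
    have h := ((hasSum_trans hR ht n).mul_right C).add hs
    rw [one_mul] at h
    refine hasSum_le (fun m => ?_) h (hη.1 t ht).hasSum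
    rw [← mul_add]
    exact mul_le_mul_of_nonneg_left (hu m) (trans_nonneg hR ht n m)
  have hint := intervalIntegrable_sum_mul_trans hR s u n T
  calc C + ∑ m ∈ s, u m * Q.occupation d n T m
      = 1 / T * ∫ t in (0 : ℝ)..T, (C + ∑ m ∈ s, u m * Q.trans d t n m) := by
        rw [sum_mul_occupation hR, intervalIntegral.integral_add intervalIntegrable_const hint,
          intervalIntegral.integral_const, smul_eq_mul, sub_zero, mul_add, ← mul_assoc,
          one_div_mul_cancel hT.ne', one_mul]
    _ ≤ _ := mul_le_mul_of_nonneg_left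
        (intervalIntegral.integral_mono_on hT.le (intervalIntegrable_const.add hint)
          (hη.2.1 T hT.le) fun t ht => pointwise ht.1) (one_div_nonneg.2 hT.le)

section Limit

variable {l : Filter ℝ} [l.NeBot] (hl : l ≤ atTop) {x : ℕ → ℝ}
  (hx : ∀ m, Tendsto (fun T => Q.occupation d n T m) l (𝓝 (x m)))
include hl hx

theorem nonneg_of_tendsto_occupation (m : ℕ) : 0 ≤ x m :=
  ge_of_tendsto (hx m) <| ((eventually_gt_atTop 0).filter_mono hl).mono fun _ hT =>
    occupation_nonneg hR n m (le_of_lt hT)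

theorem summable_of_tendsto_occupation : Summable x :=
  summable_of_sum_range_le (nonneg_of_tendsto_occupation hR hl hx) fun _ =>
    le_of_tendsto (tendsto_finsetSum _ fun m _ => hx m) <|
      ((eventually_gt_atTop 0).filter_mono hl).mono fun _ hT => sum_occupation_le_one hR n hT _

theorem balance_of_tendsto_occupation (N : ℕ) :
    Q.lam * x N = Q.deathRate d (N + 1) * x (N + 1) := by
  have hzero : Tendsto (fun T => Q.deathRate d (N + 1) * Q.occupation d n T (N + 1)
      - Q.lam * Q.occupation d n T N) l (𝓝 0) :=
    squeeze_zero_norm' (((eventually_gt_atTop 0).filter_mono hl).mono fun _ hT =>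
      abs_balance_occupation_le hR n N hT)
      ((tendsto_const_nhds.div_atTop tendsto_id).mono_left hl)
  exact (sub_eq_zero.1 (tendsto_nhds_unique
    (((hx (N + 1)).const_mul _).sub ((hx N).const_mul _)) hzero)).symm

include hη

theorem add_sum_mul_le_of_tendsto_occupation {s : Finset ℕ} {C : ℝ} {u : ℕ → ℝ}
    (hu : ∀ m, C + (if m ∈ s then u m else 0) ≤ Q.runningCost d m) :
    C + ∑ m ∈ s, u m * x m ≤ η :=
  le_of_tendsto_of_tendsto ((tendsto_finsetSum _ fun m _ => (hx m).const_mul _).const_add _)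
    (hη.2.2.mono_left hl) <|
      ((eventually_gt_atTop 0).filter_mono hl).mono fun _ hT =>
        add_sum_mul_occupation_le hR hη hu hT

variable (hc : ∀ k, 0 ≤ Q.c k) (h_mono : Monotone Q.h)
include hc h_mono

theorem ne_zero_of_tendsto_occupation (h_top : Tendsto Q.h atTop atTop) : x ≠ 0 := by
  rintro rfl
  obtain ⟨N, hN⟩ := (h_top.eventually_gt_atTop η).exists
  have h := add_sum_mul_le_of_tendsto_occupation hR hη hl hx (s := Finset.range N) (C := Q.h N)
    (u := fun _ => Q.h 0 - Q.h N) fun m => (le_trans ?_ (le_costRate hc m (d m)))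
  · simp only [Pi.zero_apply, mul_zero, Finset.sum_const_zero, add_zero] at h
    exact hN.not_ge h
  · split_ifs with hm
    · rw [add_sub_cancel]
      exact h_mono m.zero_le
    · rw [add_zero]
      exact h_mono (not_lt.1 (mt Finset.mem_range.2 hm))

theorem summable_mul_runningCost_of_tendsto_occupation :
    Summable fun m => x m * Q.runningCost d m := by
  have excess_nonneg (m : ℕ) : 0 ≤ Q.runningCost d m - Q.h 0 :=
    sub_nonneg.2 ((h_mono m.zero_le).trans (le_costRate hc m (d m)))
  have excess : Summable fun m => (Q.runningCost d m - Q.h 0) * x m := by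
    refine summable_of_sum_range_le (c := η - Q.h 0) (fun m =>
      mul_nonneg (excess_nonneg m) (nonneg_of_tendsto_occupation hR hl hx m)) fun N => ?_
    rw [le_sub_iff_add_le']
    refine add_sum_mul_le_of_tendsto_occupation hR hη hl hx fun m => ?_
    split_ifs
    · rw [add_sub_cancel]
    · linarith [excess_nonneg m]
  exact (excess.add ((summable_of_tendsto_occupation hR hl hx).mul_left (Q.h 0))).congr
    fun m => by ring

end Limit

include hη in
theorem HasAverageCost.exists_weight (hc : ∀ k, 0 ≤ Q.c k) (h_mono : Monotone Q.h)
    (h_top : Tendsto Q.h atTop atTop) :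
    ∃ b w, IsWeight Q.lam (Q.deathRate d) b w ∧ Summable fun m => w m * Q.runningCost d m := by
  let U : Ultrafilter ℝ := Ultrafilter.of atTop
  have hU : (U : Filter ℝ) ≤ atTop := Ultrafilter.of_le _
  obtain ⟨x, -, hx⟩ := (isCompact_univ_pi fun _ : ℕ =>
    isCompact_Icc (a := (0 : ℝ)) (b := 1)).ultrafilter_le_nhds' (U.map (Q.occupation d n)) <|
      ((eventually_gt_atTop 0).filter_mono hU).mono fun T hT m _ => occupation_mem_Icc hR n m hT
  have hx := tendsto_pi_nhds.1 hx
  obtain ⟨b, hw⟩ := exists_isWeight_of_balance hR.lam_pos (nonneg_of_tendsto_occupation hR hU hx)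
    (ne_zero_of_tendsto_occupation hR hη hU hx hc h_mono h_top)
    (balance_of_tendsto_occupation hR hU hx) (summable_of_tendsto_occupation hR hU hx)
  exact ⟨b, x, hw, summable_mul_runningCost_of_tendsto_occupation hR hη hU hx hc h_mono⟩

end Occupation

end GroupServerQueue

/-! ### The potential and the Poisson equation -/

namespace BirthDeath

variable {lam η : ℝ} {mu mu' f f' G w w' : ℕ → ℝ} {b N : ℕ}

/-- The Poisson equation `gen lam mu g = η - f` of a birth-death process with cost rates `f` and
average cost `η`, in terms of the increments `G n = g n - g (n - 1)`. -/
def PoissonEq (lam : ℝ) (mu f : ℕ → ℝ) (η : ℝ) (G : ℕ → ℝ) : Prop :=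
  ∀ n, lam * G (n + 1) = mu n * G n + η - f n

theorem PoissonEq.sum_mul_excess (hG : PoissonEq lam mu f η G) (h0 : mu' 0 = 0)
    (hbal : ∀ n, lam * w n = mu' (n + 1) * w (n + 1)) (N : ℕ) :
    ∑ i ∈ Finset.range (N + 1), w i * (f' i - η)
      = (∑ i ∈ Finset.range (N + 1), w i * ((f' i - mu' i * G i) - (f i - mu i * G i)))
        - lam * w N * G (N + 1) := by
  induction N with
  | zero =>
    simp only [zero_add, Finset.sum_range_one, h0]
    linear_combination w 0 * hG 0
  | succ N ih =>
    rw [Finset.sum_range_succ, Finset.sum_range_succ _ (N + 1), ih]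
    linear_combination w (N + 1) * hG (N + 1) - G (N + 1) * hbal N

theorem hasSum_of_eq_of_lt {u u' : ℕ → ℝ} {s : ℝ} (hu : HasSum u s)
    (h : ∀ n, N < n → u' n = u n) :
    HasSum u' (s + (∑ i ∈ Finset.range (N + 1), u' i - ∑ i ∈ Finset.range (N + 1), u i)) := by
  rw [← hasSum_nat_add_iff' (N + 1)]
  convert! (hasSum_nat_add_iff' (N + 1)).2 hu using 1
  · funext n
    exact h _ (by omega)
  · ring

-- Solving the balance equations downwards from `N` also covers death rates that vanish in between.
theorem IsWeight.exists_eq_of_le (hw : IsWeight lam mu b w) (hlam : 0 < lam)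
    (hmu' : ∀ n, 0 ≤ mu' n) (hbN : b ≤ N) (h : ∀ n, N < n → mu' n = mu n) :
    ∃ b' w', IsWeight lam mu' b' w' ∧ ∀ n, N ≤ n → w' n = w n := by
  let w' (n : ℕ) : ℝ := (∏ i ∈ Finset.Ioc n N, mu' i / lam) * w (max n N)
  have above (n : ℕ) (hn : N ≤ n) : w' n = w n := by
    simp only [w', Finset.Ioc_eq_empty_of_le hn, Finset.prod_empty, one_mul, max_eq_left hn]
  have balance (n : ℕ) : lam * w' n = mu' (n + 1) * w' (n + 1) := by
    rcases lt_or_ge n N with hn | hn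
    · simp only [w', max_eq_right hn.le, max_eq_right (Nat.succ_le_of_lt hn)]
      rw [← Finset.insert_Ioc_add_one_left_eq_Ioc hn, Finset.prod_insert (by simp)]
      field_simp
    · rw [above n hn, above (n + 1) (by omega), h (n + 1) (by omega), hw.balance]
  obtain ⟨b', hw'⟩ := exists_isWeight_of_balance (x := w') hlam
    (fun n => mul_nonneg (Finset.prod_nonneg fun i _ => div_nonneg (hmu' i) hlam.le) (hw.nonneg _))
    (Function.ne_iff.2 ⟨N, (above N le_rfl).trans_ne (hw.pos N hbN).ne'⟩) balance
    ((hasSum_of_eq_of_lt hw.summable.hasSum fun n hn => above n (le_of_lt hn)).summable)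
  exact ⟨b', w', hw', above⟩

theorem PoissonEq.exists_hasSum_excess {s : ℝ} (hG : PoissonEq lam mu f η G) (hlam : 0 < lam)
    (hw : IsWeight lam mu b w) (hs : HasSum (fun n => w n * (f n - η)) s) (h0 : mu 0 = 0)
    (hmu' : ∀ n, 0 ≤ mu' n) (h0' : mu' 0 = 0) (hbN : b ≤ N)
    (hmu : ∀ n, N < n → mu' n = mu n) (hf : ∀ n, N < n → f' n = f n) :
    ∃ b' w', IsWeight lam mu' b' w' ∧ w' N = w N ∧ HasSum (fun n => w' n * (f' n - η))
      (s + ∑ i ∈ Finset.range (N + 1), w' i * ((f' i - mu' i * G i) - (f i - mu i * G i))) := by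
  obtain ⟨b', w', hw', hww'⟩ := hw.exists_eq_of_le hlam hmu' hbN hmu
  refine ⟨b', w', hw', hww' N le_rfl, ?_⟩
  convert! hasSum_of_eq_of_lt (u' := fun n => w' n * (f' n - η)) hs
    (fun n hn => by rw [hww' n hn.le, hf n hn]) using 2
  rw [hG.sum_mul_excess h0' hw'.balance, hG.sum_mul_excess h0 hw.balance, hww' N le_rfl]
  simp

theorem IsWeight.exists_hasSum_excess_of_eq_zero {a : ℕ} {s : ℝ}
    (hw : IsWeight lam mu (a + 1) w) (hlam : 0 < lam) (hs : HasSum (fun n => w n * (f n - η)) s)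
    (hmu' : ∀ n, 0 ≤ mu' n) (h0' : ∀ n ≤ a, mu' n = 0)
    (hmu : ∀ n, a + 1 < n → mu' n = mu n) (hf : ∀ n, a + 1 < n → f' n = f n) :
    ∃ b' w', IsWeight lam mu' b' w' ∧ HasSum (fun n => w' n * (f' n - η))
      (s + w (a + 1) * (mu' (a + 1) / lam * (f' a - η) + (f' (a + 1) - f (a + 1)))) := by
  obtain ⟨b', w', hw', hww'⟩ := hw.exists_eq_of_le hlam hmu' le_rfl hmu
  have w'_zero (n : ℕ) (hn : n < a) : w' n = 0 := by
    have hbal := hw'.balance n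
    rw [h0' _ hn, zero_mul] at hbal
    exact (mul_eq_zero.1 hbal).resolve_left hlam.ne'
  have w'_bottom : w' a = mu' (a + 1) / lam * w (a + 1) := by
    rw [div_mul_eq_mul_div, eq_div_iff hlam.ne', mul_comm, hw'.balance, hww' _ le_rfl]
  refine ⟨b', w', hw', ?_⟩
  convert! hasSum_of_eq_of_lt (u' := fun n => w' n * (f' n - η)) hs
    (fun n hn => by rw [hww' n hn.le, hf n hn]) using 2
  rw [Finset.sum_range_succ, Finset.sum_range_succ, Finset.sum_range_succ,
    Finset.sum_eq_zero fun n hn => by rw [w'_zero n (Finset.mem_range.1 hn), zero_mul],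
    Finset.sum_eq_zero fun n hn => by rw [hw.zero n (Finset.mem_range.1 hn), zero_mul],
    hww' _ le_rfl, w'_bottom]
  ring

end BirthDeath

namespace GroupServerQueue

open BirthDeath

variable {K : ℕ} {Q : GroupServerQueue K} {d : ℕ → Fin K → ℕ} {w : ℕ → ℝ} {η : ℝ}
  (hR : Rates Q.lam Q.unifRate (Q.deathRate d)) (hw : IsWeight Q.lam (Q.deathRate d) 0 w)
  (hs : HasSum (fun n => w n * (Q.runningCost d n - η)) 0)
include hR hw hs

theorem gen_excessCost {T : ℝ} (hT : 0 ≤ T) (n : ℕ) :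
    gen Q.lam (Q.deathRate d) (Q.excessCost d η T) n = Q.meanCost d T n - Q.runningCost d n := by
  have hv := (hw.hasSum_mul_of_hasSum_mul_sub hs).summable
  have hmean {t : ℝ} (ht : 0 ≤ t) : Q.meanCost d t = Q.transOp d t (Q.runningCost d) :=
    funext fun m => meanCost_eq_transOp hR hw hv m.zero_le ht
  have hint (m : ℕ) : IntervalIntegrable (fun t => Q.meanCost d t m - η) volume 0 T :=
    ((hasAverageCost_of_hasSum_excess hR hw hs m.zero_le).2.1 T hT).sub intervalIntegrable_const
  calc gen Q.lam (Q.deathRate d) (Q.excessCost d η T) n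
      = ∫ t in (0 : ℝ)..T, gen Q.lam (Q.deathRate d) (Q.meanCost d t) n := by
        simp only [gen_apply, excessCost]
        rw [← intervalIntegral.integral_sub (hint _) (hint _),
          ← intervalIntegral.integral_sub (hint _) (hint _),
          ← intervalIntegral.integral_const_mul, ← intervalIntegral.integral_const_mul,
          ← intervalIntegral.integral_sub (((hint _).sub (hint _)).const_mul _)
            (((hint _).sub (hint _)).const_mul _)]
        simp only [sub_sub_sub_cancel_right]
    _ = ∫ t in (0 : ℝ)..T,
          Q.transOp d t (gen Q.lam (Q.deathRate d) (Q.runningCost d)) n := by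
        refine intervalIntegral.integral_congr fun t ht => ?_
        rw [Set.uIcc_of_le hT] at ht
        simp only [hmean ht.1]
        exact hw.gen_semigroup hR hv n.zero_le t
    _ = Q.meanCost d T n - Q.runningCost d n := by
        rw [hmean hT]
        exact integral_semigroup_gen hR.unif_pos.ne' (hw.hasBoundedIterates hR hv n.zero_le) T

theorem tendsto_gen_excessCost (n : ℕ) :
    Tendsto (fun T => gen Q.lam (Q.deathRate d) (Q.excessCost d η T) n) atTop
      (𝓝 (η - Q.runningCost d n)) := by
  have h := (tendsto_meanCost_of_hasSum_excess hR hw hs n.zero_le).sub_const (Q.runningCost d n)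
  rw [zero_div, add_zero] at h
  refine h.congr' ?_
  filter_upwards [eventually_ge_atTop 0] with T hT
  exact (gen_excessCost hR hw hs hT n).symm

theorem exists_tendsto_excessCost_sub (n : ℕ) :
    ∃ x, Tendsto (fun T => Q.excessCost d η T (n + 1) - Q.excessCost d η T n) atTop (𝓝 x) := by
  have solve_up {n : ℕ} {y : ℝ} (hy : Tendsto (fun T => Q.deathRate d n
      * (Q.excessCost d η T n - Q.excessCost d η T (n - 1))) atTop (𝓝 y)) :
      ∃ x, Tendsto (fun T => Q.excessCost d η T (n + 1) - Q.excessCost d η T n) atTop (𝓝 x) := by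
    refine ⟨_, (((tendsto_gen_excessCost hR hw hs n).add hy).div_const Q.lam).congr fun T => ?_⟩
    rw [gen_apply, sub_add_cancel, mul_div_cancel_left₀ _ hR.lam_pos.ne']
  induction n with
  | zero => exact solve_up (y := 0) (by simp)
  | succ n ih =>
    obtain ⟨x, hx⟩ := ih
    exact solve_up (hx.const_mul _)

theorem exists_isPotential : ∃ g, Q.IsPotential d η g := by
  choose G hG using exists_tendsto_excessCost_sub hR hw hs
  refine ⟨fun n => ∑ i ∈ Finset.range n, G i, fun n => ?_⟩
  simp only [Finset.range_zero, Finset.sum_empty, sub_zero]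
  refine (tendsto_finsetSum (Finset.range n) fun i _ => hG i).congr fun T => ?_
  exact Finset.sum_range_sub (Q.excessCost d η T) n

theorem IsPotential.poissonEq {g : ℕ → ℝ} (hg : Q.IsPotential d η g) :
    PoissonEq Q.lam (Q.deathRate d) (Q.runningCost d) η (prf g) := by
  intro n
  have hdiff (n m : ℕ) : Tendsto (fun T => Q.excessCost d η T n - Q.excessCost d η T m) atTop
      (𝓝 (g n - g m)) := by
    simpa only [sub_sub_sub_cancel_right] using (hg n).sub (hg m)
  have h := tendsto_nhds_unique (tendsto_gen_excessCost hR hw hs n)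
    (((hdiff (n + 1) n).const_mul Q.lam).sub ((hdiff n (n - 1)).const_mul (Q.deathRate d n)))
  simp only [prf, Nat.add_sub_cancel]
  linarith

end GroupServerQueue

/-! ### Greedy allocations -/

namespace GroupServerQueue

variable {ι : Type*}

section Greedy

variable [LinearOrder ι] [LocallyFiniteOrderBot ι]

theorem induction_on_isLowerSet {p : Finset ι → Prop} (empty : p ∅)
    (step : ∀ a, p (Finset.Iio a) → p (Finset.Iic a)) (s : Finset ι)
    (hs : IsLowerSet (s : Set ι)) : p s := by
  induction s using Finset.induction_on_max with
  | empty => exact empty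
  | insert a s ha ih =>
    have hIio : Finset.Iio a = s := by
      ext i
      refine ⟨fun hi => ?_, fun hi => Finset.mem_Iio.2 (ha i hi)⟩
      have hi := Finset.mem_Iio.1 hi
      exact (Finset.mem_insert.1 (hs hi.le (Finset.mem_insert_self a s))).resolve_left hi.ne
    rw [← hIio, Finset.Iio_insert]
    refine step a (hIio ▸ ih ?_)
    simp [← hIio, isLowerSet_Iio]

/-- The allocation of `n` customers to groups `k` of `M k` servers in the order of the groups. -/
def greedy (M : ι → ℕ) (n : ℕ) (k : ι) : ℕ :=
  min (M k) (n - ∑ l ∈ Finset.Iio k, M l)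

theorem greedy_le (M : ι → ℕ) (n : ℕ) (k : ι) : greedy M n k ≤ M k :=
  min_le_left _ _

theorem greedy_zero (M : ι → ℕ) (k : ι) : greedy M 0 k = 0 := by
  simp [greedy]

theorem greedy_mono (M : ι → ℕ) (k : ι) : Monotone fun n => greedy M n k :=
  fun _ _ h => min_le_min le_rfl (Nat.sub_le_sub_right h _)

theorem sum_greedy (M : ι → ℕ) (n : ℕ) {s : Finset ι} (hs : IsLowerSet (s : Set ι)) :
    ∑ k ∈ s, greedy M n k = min (∑ k ∈ s, M k) n := by
  refine induction_on_isLowerSet (p := fun s => ∑ k ∈ s, greedy M n k = min (∑ k ∈ s, M k) n)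
    (by simp) (fun a ih => ?_) s hs
  rw [← Finset.add_sum_Iio_eq_sum_Iic, ← Finset.add_sum_Iio_eq_sum_Iic, ih, greedy]
  omega

theorem min_sub_sum_greedy (M : ι → ℕ) (n : ℕ) (k : ι) :
    min (M k) (n - ∑ l ∈ Finset.Iio k, greedy M n l) = greedy M n k := by
  rw [sum_greedy M n (by simp [isLowerSet_Iio]), greedy]
  omega

theorem eq_greedy_of_eq_min [WellFoundedLT ι] {M m : ι → ℕ} {n : ℕ} {k : ι}
    (h : ∀ l ≤ k, m l = min (M l) (n - ∑ i ∈ Finset.Iio l, m i)) : m k = greedy M n k := by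
  induction k using WellFoundedLT.induction with
  | ind k ih =>
    have below (l : ι) (hl : l ∈ Finset.Iio k) : m l = greedy M n l :=
      have hl := Finset.mem_Iio.1 hl
      ih l hl fun i hi => h i (hi.trans hl.le)
    rw [h k le_rfl, Finset.sum_congr rfl below, min_sub_sum_greedy]

end Greedy

section Allocations

variable [Fintype ι]

/-- The ways to let at most `n` customers be served by groups `k` of `M k` servers. -/
def allocations (M : ι → ℕ) (n : ℕ) : Set (ι → ℕ) :=
  {m | (∀ k, m k ≤ M k) ∧ ∑ k, m k ≤ n}

theorem zero_mem_allocations (M : ι → ℕ) (n : ℕ) : 0 ∈ allocations M n :=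
  ⟨fun _ => Nat.zero_le _, by simp⟩

theorem mem_allocations_of_le {M m m' : ι → ℕ} {n : ℕ} (hm : m ∈ allocations M n)
    (h : ∀ k, m' k ≤ m k) : m' ∈ allocations M n :=
  ⟨fun k => (h k).trans (hm.1 k), (Finset.sum_le_sum fun k _ => h k).trans hm.2⟩

section Update

variable [DecidableEq ι]

theorem sum_update_mul {R : Type*} [CommSemiring R] (m : ι → ℕ) (k : ι) (j : ℕ) (u : ι → R) :
    ∑ i, (Function.update m k j i : R) * u i + m k * u k = ∑ i, (m i : R) * u i + j * u k := by
  rw [← Finset.add_sum_erase _ _ (Finset.mem_univ k),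
    ← Finset.add_sum_erase (a := k) _ (fun i => (m i : R) * u i) (Finset.mem_univ k),
    Finset.sum_congr rfl fun i hi => by rw [Function.update_of_ne (Finset.ne_of_mem_erase hi)],
    Function.update_self]
  ring

theorem sum_update (m : ι → ℕ) (k : ι) (j : ℕ) :
    ∑ i, Function.update m k j i + m k = ∑ i, m i + j := by
  simpa using sum_update_mul (R := ℕ) m k j 1

theorem update_mem_allocations {M m : ι → ℕ} {n j : ℕ} {k : ι} (hm : ∀ i, m i ≤ M i)
    (hj : j ≤ M k) (hn : ∑ i, m i + j ≤ n + m k) : Function.update m k j ∈ allocations M n := by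
  refine ⟨fun i => ?_, by have := sum_update m k j; omega⟩
  rcases eq_or_ne i k with rfl | hi
  · rwa [Function.update_self]
  · rw [Function.update_of_ne hi]
    exact hm i

end Update

section Maximizer

variable {M m : ι → ℕ} {n : ℕ} {v : ι → ℝ} (hm : m ∈ allocations M n)
  (hmax : IsMaxOn (fun m : ι → ℕ => ∑ k, (m k : ℝ) * v k) (allocations M n) m)
include hm hmax

theorem nonneg_of_isMaxOn {k : ι} (hk : 0 < m k) : 0 ≤ v k := by
  classical
  have hsum := sum_update_mul m k 0 v
  have hle := hmax (update_mem_allocations (k := k) hm.1 (Nat.zero_le _)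
    (le_add_right (by simpa using hm.2)))
  simp only [Set.mem_ofPred_eq, Nat.cast_zero, zero_mul] at hle hsum
  exact nonneg_of_mul_nonneg_right (a := (m k : ℝ)) (by linarith) (by exact_mod_cast hk)

theorem nonpos_of_isMaxOn {k : ι} (hk : m k < M k) (hn : ∑ i, m i < n) : v k ≤ 0 := by
  classical
  have hsum := sum_update_mul m k (m k + 1) v
  have hle := hmax (update_mem_allocations (k := k) hm.1 hk (by omega))
  simp only [Set.mem_ofPred_eq] at hle
  push_cast at hsum
  linarith

theorem le_of_isMaxOn {k l : ι} (hkl : k ≠ l) (hk : m k < M k) (hl : 0 < m l) : v k ≤ v l := by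
  classical
  have hsum₁ := sum_update_mul m k (m k + 1) v
  have hsum₂ := sum_update_mul (Function.update m k (m k + 1)) l (m l - 1) v
  have hcard := sum_update m k (m k + 1)
  rw [Function.update_of_ne hkl.symm] at hsum₂
  have hle := hmax (update_mem_allocations (m := Function.update m k (m k + 1)) (k := l)
    (j := m l - 1)
    (update_mem_allocations (n := n + 1) hm.1 hk (by have := hm.2; omega)).1
    ((Nat.sub_le _ _).trans (hm.1 l))
    (by rw [Function.update_of_ne hkl.symm]; have := hm.2; omega))
  simp only [Set.mem_ofPred_eq] at hle
  rw [Nat.cast_sub hl] at hsum₂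
  push_cast at hsum₁ hsum₂
  linarith

end Maximizer

variable [LinearOrder ι] [LocallyFiniteOrderBot ι]

theorem eq_min_of_isMaxOn {M m : ι → ℕ} {n : ℕ} {v : ι → ℝ} (hm : m ∈ allocations M n)
    (hmax : IsMaxOn (fun m : ι → ℕ => ∑ k, (m k : ℝ) * v k) (allocations M n) m)
    {k : ι} (hk : 0 < v k) (hlt : ∀ l, k < l → v l < v k) :
    m k = min (M k) (n - ∑ l ∈ Finset.Iio k, m l) := by
  have hIic := Finset.add_sum_Iio_eq_sum_Iic (f := m) k
  have hle : ∑ l ∈ Finset.Iic k, m l ≤ ∑ l, m l :=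
    Finset.sum_le_sum_of_subset (Finset.subset_univ _)
  have hmn := hm.2
  refine le_antisymm (le_min (hm.1 k) (by omega)) (le_of_not_gt fun hcon => ?_)
  rw [lt_min_iff] at hcon
  have hfull : ∑ l, m l = n :=
    hmn.antisymm (not_lt.1 fun h => (nonpos_of_isMaxOn hm hmax hcon.1 h).not_gt hk)
  obtain ⟨l, hl, hml⟩ : ∃ l, k < l ∧ 0 < m l := by
    by_contra! hno
    have hsub : ∑ l ∈ Finset.Iic k, m l = ∑ l, m l :=
      Finset.sum_subset (Finset.subset_univ _) fun l _ hl =>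
        Nat.le_zero.1 (hno l (not_le.1 (mt Finset.mem_Iic.2 hl)))
    omega
  exact (le_of_isMaxOn hm hmax hl.ne hcon.1 hml).not_gt (hlt l hl)

theorem greedy_mem_allocations (M : ι → ℕ) (n : ℕ) : greedy M n ∈ allocations M n :=
  ⟨greedy_le M n, (sum_greedy M n (by simp [isLowerSet_univ])).trans_le
    (min_le_right _ _)⟩

theorem sum_mul_nonneg_of_antitone {a u : ι → ℝ} (ha : ∀ k, 0 ≤ ∑ i ∈ Finset.Iic k, a i)
    (hu : Antitone u) (hu0 : ∀ k, 0 ≤ u k) : 0 ≤ ∑ k, a k * u k := by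
  suffices h : ∀ t, (∀ k ∈ Finset.univ, t ≤ u k) → t * ∑ k, a k ≤ ∑ k, a k * u k by
    simpa using h 0 fun k _ => hu0 k
  refine induction_on_isLowerSet (p := fun s => ∀ t, (∀ k ∈ s, t ≤ u k) →
    t * ∑ k ∈ s, a k ≤ ∑ k ∈ s, a k * u k) (by simp) (fun k ih t ht => ?_) Finset.univ
    (by simp [isLowerSet_univ])
  have below := ih (u k) fun i hi => hu (Finset.mem_Iio.1 hi).le
  calc t * ∑ i ∈ Finset.Iic k, a i
      ≤ u k * ∑ i ∈ Finset.Iic k, a i :=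
        mul_le_mul_of_nonneg_right (ht k (Finset.mem_Iic.2 le_rfl)) (ha k)
    _ ≤ ∑ i ∈ Finset.Iic k, a i * u i := by
        rw [← Finset.add_sum_Iio_eq_sum_Iic, ← Finset.add_sum_Iio_eq_sum_Iic]
        linarith

theorem sum_greedy_mul_concave (M : ι → ℕ) {u : ι → ℝ} (hu : Antitone u) (hu0 : ∀ k, 0 ≤ u k)
    (n : ℕ) :
    ∑ k, (greedy M (n + 2) k : ℝ) * u k - ∑ k, (greedy M (n + 1) k : ℝ) * u k
      ≤ ∑ k, (greedy M (n + 1) k : ℝ) * u k - ∑ k, (greedy M n k : ℝ) * u k := by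
  rw [← sub_nonneg]
  simp only [← Finset.sum_sub_distrib, ← sub_mul]
  refine sum_mul_nonneg_of_antitone (fun k => ?_) hu hu0
  have hk : IsLowerSet (Finset.Iic k : Set ι) := by simp [isLowerSet_Iic]
  simp only [Finset.sum_sub_distrib, ← Nat.cast_sum, sum_greedy M _ hk]
  have hmin (S : ℕ) : min S (n + 2) + min S n ≤ min S (n + 1) + min S (n + 1) := by omega
  have := hmin (∑ l ∈ Finset.Iic k, M l)
  rw [sub_nonneg, sub_le_sub_iff]
  exact_mod_cast this

end Allocations

end GroupServerQueue

/-! ### The value of service -/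

namespace GroupServerQueue

variable {K : ℕ} {Q : GroupServerQueue K} {x : ℝ} {n : ℕ} {k l : Fin K}

/-- The rate at which a working server of group `k` earns when the completion of a service is
worth `x`. -/
def serverValue (Q : GroupServerQueue K) (x : ℝ) (k : Fin K) : ℝ :=
  Q.mu k * x - Q.c k

/-- The rate at which the servers working under the action `m` earn when the completion of a
service is worth `x`. -/
noncomputable def actionValue (Q : GroupServerQueue K) (x : ℝ) (m : Fin K → ℕ) : ℝ :=
  ∑ k, (m k : ℝ) * Q.serverValue x k

/-- The largest value of an action in state `n` when the completion of a service is worth `x`: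
the groups worth using are filled greedily. -/
noncomputable def serviceValue (Q : GroupServerQueue K) (n : ℕ) (x : ℝ) : ℝ :=
  ∑ k, (greedy Q.M n k : ℝ) * max 0 (Q.serverValue x k)

theorem costRate_sub_serviceRate_mul (n : ℕ) (m : Fin K → ℕ) (x : ℝ) :
    Q.costRate n m - Q.serviceRate m * x = Q.h n - Q.actionValue x m := by
  simp only [costRate, serviceRate, actionValue, serverValue, mul_sub, Finset.sum_sub_distrib,
    Finset.sum_mul, mul_assoc]
  ring

section ServerValue

variable (hmu : ∀ k, 0 < Q.mu k)
include hmu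

theorem serverValue_mono (k : Fin K) : Monotone fun x => Q.serverValue x k :=
  fun _ _ h => sub_le_sub_right (mul_le_mul_of_nonneg_left h (hmu k).le) _

theorem serverValue_pos_iff : 0 < Q.serverValue x k ↔ Q.c k / Q.mu k < x := by
  rw [serverValue, sub_pos, div_lt_iff₀ (hmu k), mul_comm]

theorem serverValue_neg_iff : Q.serverValue x k < 0 ↔ x < Q.c k / Q.mu k := by
  rw [serverValue, sub_neg, lt_div_iff₀ (hmu k), mul_comm]

theorem serverValue_eq (x : ℝ) (k : Fin K) :
    Q.serverValue x k = Q.mu k * (x - Q.c k / Q.mu k) := by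
  rw [serverValue, mul_sub, mul_div_cancel₀ _ (hmu k).ne']

variable (h_sorted : Monotone fun k => Q.c k / Q.mu k) (h_scale : Antitone Q.mu)
include h_sorted h_scale

theorem serverValue_le_of_le (hkl : k ≤ l) (hl : 0 < Q.serverValue x l) :
    Q.serverValue x l ≤ Q.serverValue x k := by
  have hratio : Q.c k / Q.mu k ≤ Q.c l / Q.mu l := h_sorted hkl
  have hx := (serverValue_pos_iff hmu).1 hl
  rw [serverValue_eq hmu, serverValue_eq hmu]
  exact mul_le_mul (h_scale hkl) (by linarith) (by linarith) (hmu k).le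

theorem antitone_max_serverValue (x : ℝ) : Antitone fun k => max 0 (Q.serverValue x k) := by
  refine fun k l hkl => max_le (le_max_left _ _) ?_
  rcases le_or_gt (Q.serverValue x l) 0 with hl | hl
  · exact hl.trans (le_max_left _ _)
  · exact (serverValue_le_of_le hmu h_sorted h_scale hkl hl).trans (le_max_right _ _)

theorem serverValue_lt_of_lt (h_het : ∀ k l, k ≠ l → ¬(Q.c k = Q.c l ∧ Q.mu k = Q.mu l))
    (hkl : k < l) (hk : 0 < Q.serverValue x k) : Q.serverValue x l < Q.serverValue x k := by
  rcases le_or_gt (Q.serverValue x l) 0 with hl | hl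
  · exact hl.trans_lt hk
  refine (serverValue_le_of_le hmu h_sorted h_scale hkl.le hl).lt_of_ne fun heq => ?_
  have hratio : Q.c k / Q.mu k ≤ Q.c l / Q.mu l := h_sorted hkl.le
  have hx := (serverValue_pos_iff hmu).1 hl
  rw [serverValue_eq hmu, serverValue_eq hmu] at heq
  have hrate : Q.mu l = Q.mu k := by
    refine (h_scale hkl.le).antisymm (le_of_mul_le_mul_right ?_ (sub_pos.2 hx))
    rw [heq]
    exact mul_le_mul_of_nonneg_left (by linarith) (hmu k).le
  rw [hrate] at heq
  have hcost := mul_left_cancel₀ (hmu k).ne' heq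
  rw [sub_right_inj, div_left_inj' (hmu k).ne'] at hcost
  exact h_het k l hkl.ne ⟨hcost.symm, hrate.symm⟩

end ServerValue

/-! ### The optimality recursion -/

/-- The properties of the value `φ n x` of having `n` customers to serve, when the completion of a
service is worth `x`, that make the increments of the potential monotone. -/
structure IsValueFunction (φ : ℕ → ℝ → ℝ) : Prop where
  zero : φ 0 = 0
  mono : ∀ n, Monotone (φ n)
  diff_mono : ∀ n, Monotone fun x => φ (n + 1) x - φ n x
  concave : ∀ n x, φ (n + 2) x - φ (n + 1) x ≤ φ (n + 1) x - φ n x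
  bounded : ∀ x, ∃ C, ∀ n, φ n x ≤ C

theorem isValueFunction_serviceValue (hmu : ∀ k, 0 < Q.mu k)
    (h_sorted : Monotone fun k => Q.c k / Q.mu k) (h_scale : Antitone Q.mu) :
    IsValueFunction Q.serviceValue := by
  have value_mono {x y : ℝ} (h : x ≤ y) (k : Fin K) :
      max 0 (Q.serverValue x k) ≤ max 0 (Q.serverValue y k) :=
    max_le_max le_rfl (serverValue_mono hmu k h)
  refine ⟨?_, fun n x y h => ?_, fun n x y h => ?_, fun n x => ?_, fun x => ?_⟩
  · funext x
    simp [serviceValue, greedy_zero]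
  · exact Finset.sum_le_sum fun k _ =>
      mul_le_mul_of_nonneg_left (value_mono h k) (Nat.cast_nonneg _)
  · simp only [serviceValue, ← Finset.sum_sub_distrib, ← sub_mul]
    exact Finset.sum_le_sum fun k _ => mul_le_mul_of_nonneg_left (value_mono h k)
      (sub_nonneg.2 (Nat.cast_le.2 (greedy_mono Q.M k n.le_succ)))
  · exact sum_greedy_mul_concave Q.M (antitone_max_serverValue hmu h_sorted h_scale x)
      (fun k => le_max_left _ _) n
  · exact ⟨∑ k, (Q.M k : ℝ) * max 0 (Q.serverValue x k), fun n => Finset.sum_le_sum fun k _ =>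
      mul_le_mul_of_nonneg_right (Nat.cast_le.2 (greedy_le Q.M n k)) (le_max_left _ _)⟩

namespace IsValueFunction

variable {lam η : ℝ} {h : ℕ → ℝ} {φ : ℕ → ℝ → ℝ} {G : ℕ → ℝ} {N : ℕ} (hφ : IsValueFunction φ)
  (hlam : 0 < lam) (hG : ∀ n, lam * G (n + 1) = η - h n + φ n (G n))
include hφ hlam hG

section Convex

variable (h_convex : ∀ n, h (n + 1) - h n ≤ h (n + 2) - h (n + 1))
include h_convex

theorem lt_of_lt (hlt : G (N + 1) < G N)
    (hmarg : φ (N + 1) (G N) - φ N (G N) < h (N + 1) - h N) {n : ℕ} (hn : N ≤ n) :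
    G (n + 1) < G n ∧ φ (n + 1) (G n) - φ n (G n) < h (n + 1) - h n := by
  induction n, hn using Nat.le_induction with
  | base => exact ⟨hlt, hmarg⟩
  | succ n _ ih =>
    have hval := hφ.mono (n + 1) ih.1.le
    have hdiff := hφ.diff_mono n ih.1.le
    simp only at hdiff
    refine ⟨lt_of_mul_lt_mul_left ?_ hlam.le, ?_⟩
    · linarith [hG n, hG (n + 1), ih.2]
    · linarith [hφ.concave n (G (n + 1)), h_convex n, ih.2]

variable (h_top : Tendsto h atTop atTop)
include h_top

theorem exists_neg_of_lt (hlt : G (N + 1) < G N)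
    (hmarg : φ (N + 1) (G N) - φ N (G N) < h (N + 1) - h N) : ∃ n, G (n + 1) < 0 := by
  have hle {n : ℕ} (hn : N ≤ n) : G n ≤ G N := by
    induction n, hn using Nat.le_induction with
    | base => exact le_rfl
    | succ n hn ih => exact (hφ.lt_of_lt hlam hG h_convex hlt hmarg hn).1.le.trans ih
  obtain ⟨C, hC⟩ := hφ.bounded (G N)
  obtain ⟨n, hn, hNn⟩ := ((h_top.eventually_gt_atTop (η + C)).and (eventually_ge_atTop N)).exists
  refine ⟨n, neg_of_mul_neg_right (a := lam) ?_ hlam.le⟩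
  linarith [hG n, hφ.mono n (hle hNn), hC n]

variable (hnonneg : ∀ n, 0 ≤ G (n + 1))
include hnonneg

theorem le_succ_of_value_le {n : ℕ} (hle : φ n (G n) ≤ φ n (G (n + 1))) :
    G (n + 1) ≤ G (n + 2) := by
  by_contra! hlt
  have hstep := mul_lt_mul_of_pos_left hlt hlam
  obtain ⟨m, hm⟩ := hφ.exists_neg_of_lt hlam hG h_convex h_top hlt
    (by linarith [hG n, hG (n + 1), hφ.concave n (G (n + 1)), h_convex n])
  exact (hnonneg m).not_gt hm

theorem monotoneOn : MonotoneOn G (Set.Ici 1) := by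
  refine monotoneOn_nat_Ici_of_le_succ fun n hn => ?_
  induction n, hn using Nat.le_induction with
  | base => exact hφ.le_succ_of_value_le hlam hG h_convex h_top hnonneg (by simp [hφ.zero])
  | succ n _ ih => exact hφ.le_succ_of_value_le hlam hG h_convex h_top hnonneg (hφ.mono n ih)

end Convex

theorem exists_lt (h_top : Tendsto h atTop atTop) (hmono : MonotoneOn G (Set.Ici 1)) (B : ℝ) :
    ∃ n, 1 ≤ n ∧ B < G n := by
  by_contra! hle
  obtain ⟨C, hC⟩ := hφ.bounded B
  obtain ⟨n, hn, h1n⟩ := ((h_top.eventually_gt_atTop (η + C - lam * G 1)).and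
    (eventually_ge_atTop 1)).exists
  have hG1 : lam * G 1 ≤ lam * G (n + 1) := mul_le_mul_of_nonneg_left
    (hmono (Set.mem_Ici.2 le_rfl) (Set.mem_Ici.2 (by omega)) (by omega)) hlam.le
  linarith [hG n, hφ.mono n (hle n h1n), hC n]

end IsValueFunction

end GroupServerQueue

/-! ### Optimal policies -/

namespace GroupServerQueue

open BirthDeath

variable {K : ℕ} {Q : GroupServerQueue K} {d d' : ℕ → Fin K → ℕ} {b : ℕ} {w G : ℕ → ℝ} {η : ℝ}
  {k : Fin K}

theorem serviceRate_zero : Q.serviceRate 0 = 0 := by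
  simp [serviceRate]

theorem costRate_zero (n : ℕ) : Q.costRate n 0 = Q.h n := by
  simp [costRate]

theorem serviceRate_single (k : Fin K) : Q.serviceRate (Pi.single k 1) = Q.mu k := by
  rw [serviceRate, Finset.sum_eq_single k] <;> simp +contextual

theorem costRate_single (n : ℕ) (k : Fin K) :
    Q.costRate n (Pi.single k 1) = Q.h n + Q.c k := by
  rw [costRate, Finset.sum_eq_single k] <;> simp +contextual

theorem single_mem_allocations {n : ℕ} (hk : 0 < Q.M k) (hn : 0 < n) :
    Pi.single k 1 ∈ allocations Q.M n := by
  refine ⟨fun l => ?_, by simpa using Nat.succ_le_of_lt hn⟩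
  rcases eq_or_ne l k with rfl | hl
  · simpa using Nat.succ_le_of_lt hk
  · simp [hl]

theorem IsEfficient.update (hd : Q.IsEfficient d) {n : ℕ} {m : Fin K → ℕ}
    (hm : m ∈ allocations Q.M n) : Q.IsEfficient (Function.update d n m) := by
  intro i
  rcases eq_or_ne i n with rfl | hi
  · rwa [Function.update_self]
  · rw [Function.update_of_ne hi]
    exact hd i

section Cheapest

variable (hd : Q.IsEfficient d) (hmu : ∀ k, 0 < Q.mu k)
include hd hmu

theorem exists_cheapest_group {n : ℕ} (hn : 0 < Q.deathRate d n) :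
    ∃ k, 0 < Q.M k ∧ ∀ l, 0 < Q.M l → Q.c k / Q.mu k ≤ Q.c l / Q.mu l := by
  have hne : (Finset.univ.filter fun k => 0 < Q.M k).Nonempty := by
    by_contra hempty
    refine hn.ne' ((serviceRate_eq_zero_iff hmu _).2 fun k => ?_)
    have hk : ¬ 0 < Q.M k := fun hk => hempty ⟨k, by simpa using hk⟩
    have := (hd n).1 k
    omega
  obtain ⟨k, hk, hmin⟩ := Finset.exists_min_image _ (fun k => Q.c k / Q.mu k) hne
  exact ⟨k, by simpa using hk, fun l hl => hmin l (by simpa using hl)⟩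

variable (hk : ∀ l, 0 < Q.M l → Q.c k / Q.mu k ≤ Q.c l / Q.mu l)
include hk

theorem cheapest_mul_deathRate_le (n : ℕ) :
    Q.h n + Q.c k / Q.mu k * Q.deathRate d n ≤ Q.runningCost d n := by
  unfold runningCost deathRate costRate serviceRate
  rw [Finset.mul_sum]
  refine add_le_add_right (Finset.sum_le_sum fun l _ => ?_) _
  rcases Nat.eq_zero_or_pos (d n l) with h | h
  · simp [h]
  · have hl := hk l (h.trans_le ((hd n).1 l))
    rw [le_div_iff₀ (hmu l)] at hl
    calc Q.c k / Q.mu k * (d n l * Q.mu l) = d n l * (Q.c k / Q.mu k * Q.mu l) := by ring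
      _ ≤ d n l * Q.c l := mul_le_mul_of_nonneg_left hl (Nat.cast_nonneg _)

-- Under stationarity the work served per unit of time is `lam`, whatever the policy.
theorem holding_add_work_lt (h_mono : Monotone Q.h) (h_top : Tendsto Q.h atTop atTop)
    (h0 : Q.deathRate d 0 = 0) (hw : IsWeight Q.lam (Q.deathRate d) b w)
    (hs : HasSum (fun n => w n * (Q.runningCost d n - η)) 0) :
    Q.h b + Q.lam * (Q.c k / Q.mu k) < η := by
  have hgap : HasSum (fun n => w n * Q.runningCost d n
      - Q.c k / Q.mu k * (w n * Q.deathRate d n) - Q.h b * w n)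
      ((η - (Q.h b + Q.lam * (Q.c k / Q.mu k))) * ∑' n, w n) := by
    convert! ((hw.hasSum_mul_of_hasSum_mul_sub hs).sub
      ((hw.hasSum_mul_mu h0).mul_left (Q.c k / Q.mu k))).sub
      (hw.summable.hasSum.mul_left (Q.h b)) using 1
    ring
  have gap_ge (n : ℕ) : w n * (Q.h n - Q.h b)
      ≤ w n * Q.runningCost d n - Q.c k / Q.mu k * (w n * Q.deathRate d n) - Q.h b * w n := by
    linarith [mul_le_mul_of_nonneg_left (cheapest_mul_deathRate_le hd hmu hk n) (hw.nonneg n)]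
  have holding_nonneg (n : ℕ) : 0 ≤ w n * (Q.h n - Q.h b) := by
    rcases lt_or_ge n b with h | h
    · rw [hw.zero n h, zero_mul]
    · exact mul_nonneg (hw.nonneg n) (sub_nonneg.2 (h_mono h))
  obtain ⟨N, hN, hbN⟩ := ((h_top.eventually_gt_atTop (Q.h b)).and (eventually_ge_atTop b)).exists
  have hpos := hgap.summable.tsum_pos (fun n => (holding_nonneg n).trans (gap_ge n)) N
    ((mul_pos (hw.pos N hbN) (sub_pos.2 hN)).trans_le (gap_ge N))
  rw [hgap.tsum_eq] at hpos
  exact sub_pos.1 (pos_of_mul_pos_left hpos hw.tsum_pos.le)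

end Cheapest

namespace IsOptimal

variable (hd : Q.IsOptimal d η) (hlam : 0 < Q.lam) (hmu : ∀ k, 0 < Q.mu k)
include hd hlam hmu

theorem nonneg_of_hasSum (hd' : Q.IsEfficient d') {s : ℝ}
    (hw : IsWeight Q.lam (Q.deathRate d') b w)
    (hs : HasSum (fun n => w n * (Q.runningCost d' n - η)) s) : 0 ≤ s := by
  have hle := hd.2.2 d' hd' b _
    (hasAverageCost_of_hasSum_excess (hd'.rates hlam hmu) hw hs le_rfl)
  have hdiv := mul_nonneg (le_add_iff_nonneg_right _ |>.1 hle) hw.tsum_pos.le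
  rwa [div_mul_cancel₀ _ hw.tsum_pos.ne'] at hdiv

theorem le_holding_add_work {a : ℕ} (hw : IsWeight Q.lam (Q.deathRate d) (a + 1) w)
    (hs : HasSum (fun n => w n * (Q.runningCost d n - η)) 0) (hk : 0 < Q.M k) :
    η ≤ Q.h a + Q.lam * (Q.c k / Q.mu k) := by
  set d' : ℕ → Fin K → ℕ := fun n =>
    if n ≤ a then 0 else Function.update d (a + 1) (Pi.single k 1) n
  have below (n : ℕ) (hn : n ≤ a) : d' n = 0 := if_pos hn
  have single : d' (a + 1) = Pi.single k 1 := by simp [d']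
  have above (n : ℕ) (hn : a + 1 < n) : d' n = d n := by
    simp [d', Function.update_of_ne hn.ne', show ¬ n ≤ a by omega]
  have heff : Q.IsEfficient d' := fun n => by
    rcases le_or_gt n a with hn | hn
    · rw [below n hn]
      exact zero_mem_allocations Q.M n
    · simp only [d', hn.not_ge, if_false]
      exact hd.1.update (single_mem_allocations hk a.succ_pos) n
  have idle : d (a + 1) = 0 :=
    funext ((serviceRate_eq_zero_iff hmu _).1 (hw.mu_bottom (hd.1.rates hlam hmu)))
  obtain ⟨b, w', hw', hsum⟩ := hw.exists_hasSum_excess_of_eq_zero (mu' := Q.deathRate d')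
    (f' := Q.runningCost d') hlam hs (fun n => serviceRate_nonneg hmu _)
    (fun n hn => by simp only [deathRate, below n hn, serviceRate_zero])
    (fun n hn => by simp only [deathRate, above n hn])
    (fun n hn => by simp only [runningCost, above n hn])
  rw [zero_add] at hsum
  have hge := nonneg_of_mul_nonneg_right (hd.nonneg_of_hasSum hlam hmu heff hw' hsum)
    (hw.pos (a + 1) le_rfl)
  simp only [deathRate, runningCost, below a le_rfl, single, idle, costRate_zero,
    costRate_single, serviceRate_single] at hge
  have hgain : Q.mu k / Q.lam * (Q.h a - η) + (Q.h (a + 1) + Q.c k - Q.h (a + 1))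
      = Q.mu k / Q.lam * (Q.h a + Q.lam * (Q.c k / Q.mu k) - η) := by
    have := (hmu k).ne'
    field_simp
    ring
  rw [hgain] at hge
  exact sub_nonneg.1 (nonneg_of_mul_nonneg_right hge (div_pos (hmu k) hlam))

theorem bottom_eq_zero (h_mono : Monotone Q.h) (h_top : Tendsto Q.h atTop atTop)
    (hw : IsWeight Q.lam (Q.deathRate d) b w)
    (hs : HasSum (fun n => w n * (Q.runningCost d n - η)) 0) : b = 0 := by
  have hR := hd.1.rates hlam hmu
  rcases b with _ | a
  · rfl
  obtain ⟨k, hkM, hk⟩ := exists_cheapest_group hd.1 hmu (hw.mu_pos hlam (a + 1).lt_succ_self)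
  have hlt := holding_add_work_lt hd.1 hmu hk h_mono h_top hR.mu_zero hw hs
  have hle := hd.le_holding_add_work hlam hmu hw hs hkM
  linarith [h_mono a.le_succ]

theorem exists_weight (hc : ∀ k, 0 ≤ Q.c k) (h_mono : Monotone Q.h)
    (h_top : Tendsto Q.h atTop atTop) :
    ∃ w, IsWeight Q.lam (Q.deathRate d) 0 w ∧
      HasSum (fun n => w n * (Q.runningCost d n - η)) 0 := by
  have hR := hd.1.rates hlam hmu
  obtain ⟨b, w, hw, hsum⟩ := (hd.2.1 0).exists_weight hR hc h_mono h_top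
  have hs : Summable fun n => w n * (Q.runningCost d n - η) :=
    (hsum.sub (hw.summable.mul_right η)).congr fun n => by ring
  have havg := (hd.2.1 b).unique (hasAverageCost_of_hasSum_excess hR hw hs.hasSum le_rfl)
  have hzero : ∑' n, w n * (Q.runningCost d n - η) = 0 :=
    (div_eq_zero_iff.1 (left_eq_add.1 havg)).resolve_right hw.tsum_pos.ne'
  have hs0 := hzero ▸ hs.hasSum
  obtain rfl := hd.bottom_eq_zero hlam hmu h_mono h_top hw hs0
  exact ⟨w, hw, hs0⟩

variable (hw : IsWeight Q.lam (Q.deathRate d) 0 w)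
  (hs : HasSum (fun n => w n * (Q.runningCost d n - η)) 0)
  (hG : PoissonEq Q.lam (Q.deathRate d) (Q.runningCost d) η G)
include hw hs hG

theorem isMaxOn_actionValue (n : ℕ) :
    IsMaxOn (Q.actionValue (G n)) (allocations Q.M n) (d n) := by
  intro m hm
  have heff := hd.1.update hm
  obtain ⟨b, w', hw', hwn, hsum⟩ := hG.exists_hasSum_excess (N := n)
    (mu' := Q.deathRate (Function.update d n m)) (f' := Q.runningCost (Function.update d n m))
    hlam hw hs (hd.1.rates hlam hmu).mu_zero (fun i => serviceRate_nonneg hmu _)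
    (heff.rates hlam hmu).mu_zero n.zero_le
    (fun i hi => by simp only [deathRate, Function.update_of_ne hi.ne'])
    (fun i hi => by simp only [runningCost, Function.update_of_ne hi.ne'])
  rw [Finset.sum_range_succ, Finset.sum_eq_zero fun i hi => by
    simp only [deathRate, runningCost, Function.update_of_ne (Finset.mem_range.1 hi).ne, sub_self,
      mul_zero]] at hsum
  simp only [deathRate, runningCost, Function.update_self, costRate_sub_serviceRate_mul, hwn,
    zero_add] at hsum
  have hgain := nonneg_of_mul_nonneg_right (hd.nonneg_of_hasSum hlam hmu heff hw' hsum)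
    (hw.pos n n.zero_le)
  exact (by linarith : Q.actionValue (G n) m ≤ Q.actionValue (G n) (d n))

theorem of_poissonEq (hd' : Q.IsEfficient d') (hpos : ∀ n, 0 < Q.deathRate d' (n + 1))
    (hG' : PoissonEq Q.lam (Q.deathRate d') (Q.runningCost d') η G) {N : ℕ}
    (hN : ∀ n, N < n → d' n = d n) : Q.IsOptimal d' η := by
  have hR' := hd'.rates hlam hmu
  obtain ⟨b, w', hw', -, hsum⟩ := hG.exists_hasSum_excess (N := N)
    (mu' := Q.deathRate d') (f' := Q.runningCost d') hlam hw hs (hd.1.rates hlam hmu).mu_zero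
    hR'.mu_nonneg hR'.mu_zero N.zero_le (fun n hn => by simp only [deathRate, hN n hn])
    (fun n hn => by simp only [runningCost, hN n hn])
  rw [Finset.sum_eq_zero fun i _ => by rw [mul_eq_zero]; right; linarith [hG i, hG' i],
    add_zero] at hsum
  have hb : b = 0 := by
    rcases b with _ | b
    · rfl
    · exact absurd (hw'.mu_bottom hR') (hpos b).ne'
  refine ⟨hd', fun n => ?_, hd.2.2⟩
  have havg := hasAverageCost_of_hasSum_excess hR' hw' hsum (hb.trans_le n.zero_le)
  rwa [zero_div, add_zero] at havg

end IsOptimal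

end GroupServerQueue

/-! ### Thresholds -/

namespace GroupServerQueue

open BirthDeath

variable {K : ℕ} {Q : GroupServerQueue K} {d : ℕ → Fin K → ℕ} {θ : Fin K → ℕ} {G : ℕ → ℝ}
  {η x : ℝ} {n : ℕ} {k : Fin K}

theorem poissonEq_iff : PoissonEq Q.lam (Q.deathRate d) (Q.runningCost d) η G ↔
    ∀ n, Q.lam * G (n + 1) = η - Q.h n + Q.actionValue (G n) (d n) := by
  refine forall_congr' fun n => ?_
  have h := costRate_sub_serviceRate_mul (Q := Q) n (d n) (G n)
  constructor <;> intro hn <;> linarith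

theorem actionValue_eq_serviceValue {m : Fin K → ℕ}
    (hpos : ∀ k, 0 < Q.serverValue x k → m k = greedy Q.M n k)
    (hneg : ∀ k, Q.serverValue x k < 0 → m k = 0) :
    Q.actionValue x m = Q.serviceValue n x := by
  refine Finset.sum_congr rfl fun k _ => ?_
  rcases lt_trichotomy (Q.serverValue x k) 0 with h | h | h
  · simp [hneg k h, max_eq_left h.le]
  · simp [h]
  · rw [hpos k h, max_eq_right h.le]

/-- The average-cost optimality equation: the efficient policy `d` has average cost `η` and
potential increments `G`, and its actions are the most valuable ones when the completion of a
service in state `n` is worth `G n`. -/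
structure IsBellmanSolution (Q : GroupServerQueue K) (d : ℕ → Fin K → ℕ) (η : ℝ) (G : ℕ → ℝ) :
    Prop where
  efficient : Q.IsEfficient d
  poissonEq : PoissonEq Q.lam (Q.deathRate d) (Q.runningCost d) η G
  isMaxOn : ∀ n, IsMaxOn (Q.actionValue (G n)) (allocations Q.M n) (d n)

/-- `θ k` is the first nonempty state in which working servers of group `k` pay off when the
completion of a service in state `n` is worth `G n`. -/
def IsThreshold (Q : GroupServerQueue K) (G : ℕ → ℝ) (θ : Fin K → ℕ) : Prop :=
  ∀ k, IsLeast {n | 1 ≤ n ∧ Q.c k / Q.mu k < G n} (θ k)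

/-- The multi-threshold policy with thresholds `θ` in closed form, for monotone `θ`. -/
def thresholdPolicy (Q : GroupServerQueue K) (θ : Fin K → ℕ) (n : ℕ) (k : Fin K) : ℕ :=
  if θ k ≤ n then greedy Q.M n k else 0

namespace IsThreshold

variable (hθ : Q.IsThreshold G θ)
include hθ

theorem monotone (h_sorted : Monotone fun k => Q.c k / Q.mu k) : Monotone θ :=
  fun k l hkl => (hθ k).2 ⟨(hθ l).1.1, (h_sorted hkl).trans_lt (hθ l).1.2⟩

theorem lt_of_le (hGmono : MonotoneOn G (Set.Ici 1)) (hn : θ k ≤ n) : Q.c k / Q.mu k < G n :=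
  (hθ k).1.2.trans_le (hGmono (hθ k).1.1 ((hθ k).1.1.trans hn) hn)

theorem actionValue_thresholdPolicy (hmu : ∀ k, 0 < Q.mu k) (hGmono : MonotoneOn G (Set.Ici 1))
    (n : ℕ) : Q.actionValue (G n) (Q.thresholdPolicy θ n) = Q.serviceValue n (G n) := by
  refine actionValue_eq_serviceValue (fun k hk => ?_) fun k hk => if_neg fun hn => ?_
  · rcases n.eq_zero_or_pos with rfl | hn
    · simp [thresholdPolicy, greedy_zero]
    · exact if_pos ((hθ k).2 ⟨hn, (serverValue_pos_iff hmu).1 hk⟩)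
  · exact (hθ.lt_of_le hGmono hn).not_gt ((serverValue_neg_iff hmu).1 hk)

end IsThreshold

theorem isEfficient_thresholdPolicy (Q : GroupServerQueue K) (θ : Fin K → ℕ) :
    Q.IsEfficient (Q.thresholdPolicy θ) := fun n =>
  mem_allocations_of_le (greedy_mem_allocations Q.M n) fun k => by
    unfold thresholdPolicy
    split_ifs
    · exact le_rfl
    · exact Nat.zero_le _

theorem isMultiThreshold_thresholdPolicy (hθ : Monotone θ) :
    Q.IsMultiThreshold θ (Q.thresholdPolicy θ) := by
  intro n k
  unfold thresholdPolicy maxOn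
  split_ifs with hk
  · rw [← min_sub_sum_greedy]
    congr 2
    exact Finset.sum_congr rfl fun l hl =>
      (if_pos ((hθ (Finset.mem_Iio.1 hl).le).trans hk)).symm
  · rfl

theorem deathRate_thresholdPolicy_pos (hmu : ∀ k, 0 < Q.mu k) (hθ : Monotone θ)
    (hM : 0 < Q.M k) (hk : θ k ≤ n) (hn : 0 < n) : 0 < Q.deathRate (Q.thresholdPolicy θ) n := by
  refine (serviceRate_nonneg hmu _).lt_of_ne' fun hidle => ?_
  rw [serviceRate_eq_zero_iff hmu] at hidle
  have hzero : ∑ l ∈ Finset.Iic k, greedy Q.M n l = 0 := Finset.sum_eq_zero fun l hl => by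
    rw [← hidle l, thresholdPolicy, if_pos ((hθ (Finset.mem_Iic.1 hl)).trans hk)]
  have hMk : Q.M k ≤ ∑ l ∈ Finset.Iic k, Q.M l :=
    Finset.single_le_sum (fun l _ => Nat.zero_le _) (Finset.mem_Iic.2 le_rfl)
  rw [sum_greedy _ _ (by simp [isLowerSet_Iic])] at hzero
  omega

namespace IsBellmanSolution

variable (hB : Q.IsBellmanSolution d η G)
include hB

theorem lt_one (hlam : 0 < Q.lam) (hk : Q.h 0 + Q.lam * (Q.c k / Q.mu k) < η) :
    Q.c k / Q.mu k < G 1 := by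
  have h1 := poissonEq_iff.1 hB.poissonEq 0
  simp only [actionValue, hB.efficient.apply_zero, Nat.cast_zero, zero_mul,
    Finset.sum_const_zero, add_zero, zero_add] at h1
  exact lt_of_mul_lt_mul_left (by linarith) hlam.le

variable (hmu : ∀ k, 0 < Q.mu k)
include hmu

theorem eq_zero (hk : G n < Q.c k / Q.mu k) : d n k = 0 := by
  by_contra hne
  exact (nonneg_of_isMaxOn (hB.efficient n) (hB.isMaxOn n) (Nat.pos_of_ne_zero hne)).not_gt
    ((serverValue_neg_iff hmu).2 hk)

theorem eq_zero_or_eq (hθ : Q.IsThreshold G θ) (hn : n < θ k) :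
    d n k = 0 ∨ 1 ≤ n ∧ G n = Q.c k / Q.mu k := by
  rcases n.eq_zero_or_pos with rfl | h1
  · exact Or.inl (hB.efficient.apply_zero k)
  rcases lt_trichotomy (G n) (Q.c k / Q.mu k) with h | h | h
  · exact Or.inl (hB.eq_zero hmu h)
  · exact Or.inr ⟨h1, h⟩
  · exact absurd ((hθ k).2 ⟨h1, h⟩) hn.not_ge

theorem increment_nonneg (hc : ∀ k, 0 ≤ Q.c k) (hn : 0 < Q.deathRate d n) : 0 ≤ G n := by
  by_contra! hneg
  exact hn.ne' ((serviceRate_eq_zero_iff hmu _).2 fun k =>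
    hB.eq_zero hmu (hneg.trans_le (div_nonneg (hc k) (hmu k).le)))

variable (h_sorted : Monotone fun k => Q.c k / Q.mu k) (h_scale : Antitone Q.mu)
  (h_het : ∀ k l, k ≠ l → ¬(Q.c k = Q.c l ∧ Q.mu k = Q.mu l))
include h_sorted h_scale h_het

theorem eq_maxOn (hk : Q.c k / Q.mu k < G n) : d n k = Q.maxOn d n k := by
  have hpos := (serverValue_pos_iff hmu).2 hk
  exact eq_min_of_isMaxOn (hB.efficient n) (hB.isMaxOn n) hpos fun l hl =>
    serverValue_lt_of_lt hmu h_sorted h_scale h_het hl hpos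

theorem eq_greedy (hk : Q.c k / Q.mu k < G n) : d n k = greedy Q.M n k :=
  eq_greedy_of_eq_min fun _ hl =>
    hB.eq_maxOn hmu h_sorted h_scale h_het ((h_sorted hl).trans_lt hk)

theorem lam_mul_succ (n : ℕ) : Q.lam * G (n + 1) = η - Q.h n + Q.serviceValue n (G n) := by
  rw [poissonEq_iff.1 hB.poissonEq n, actionValue_eq_serviceValue
    (fun k hk => hB.eq_greedy hmu h_sorted h_scale h_het ((serverValue_pos_iff hmu).1 hk))
    fun k hk => hB.eq_zero hmu ((serverValue_neg_iff hmu).1 hk)]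

variable (hlam : 0 < Q.lam) (h_top : Tendsto Q.h atTop atTop)
include hlam h_top

theorem monotoneOn (hc : ∀ k, 0 ≤ Q.c k)
    (h_convex : ∀ n, Q.h (n + 1) - Q.h n ≤ Q.h (n + 2) - Q.h (n + 1))
    (hpos : ∀ n, 0 < Q.deathRate d (n + 1)) : MonotoneOn G (Set.Ici 1) :=
  (isValueFunction_serviceValue hmu h_sorted h_scale).monotoneOn hlam
    (hB.lam_mul_succ hmu h_sorted h_scale h_het) h_convex h_top
    fun n => hB.increment_nonneg hmu hc (hpos n)

variable (hGmono : MonotoneOn G (Set.Ici 1))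
include hGmono

theorem exists_isThreshold : ∃ θ, Q.IsThreshold G θ := by
  classical
  have hex (k : Fin K) : ∃ n, 1 ≤ n ∧ Q.c k / Q.mu k < G n :=
    (isValueFunction_serviceValue hmu h_sorted h_scale).exists_lt hlam
      (hB.lam_mul_succ hmu h_sorted h_scale h_het) h_top hGmono _
  exact ⟨fun k => Nat.find (hex k), fun k => Nat.isLeast_find (hex k)⟩

omit hlam h_top in
theorem poissonEq_thresholdPolicy (hθ : Q.IsThreshold G θ) :
    PoissonEq Q.lam (Q.deathRate (Q.thresholdPolicy θ)) (Q.runningCost (Q.thresholdPolicy θ))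
      η G :=
  poissonEq_iff.2 fun n => by
    rw [hθ.actionValue_thresholdPolicy hmu hGmono, hB.lam_mul_succ hmu h_sorted h_scale h_het]

omit hlam h_top in
theorem thresholdPolicy_eq (hθ : Q.IsThreshold G θ) (hn : Finset.univ.sup θ ≤ n) :
    Q.thresholdPolicy θ n = d n := by
  funext k
  have hk : θ k ≤ n := (Finset.le_sup (f := θ) (Finset.mem_univ k)).trans hn
  rw [thresholdPolicy, if_pos hk, hB.eq_greedy hmu h_sorted h_scale h_het (hθ.lt_of_le hGmono hk)]

end IsBellmanSolution

end GroupServerQueue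

open GroupServerQueue

theorem theorem9 {K : ℕ} (Q : GroupServerQueue K)
    (hlam : 0 < Q.lam) (hmu : ∀ k, 0 < Q.mu k) (hc : ∀ k, 0 ≤ Q.c k)
    -- the holding cost is increasing, convex and unbounded
    (h_mono : Monotone Q.h)
    (h_convex : ∀ n, Q.h (n + 1) - Q.h n ≤ Q.h (n + 2) - Q.h (n + 1))
    (h_top : Filter.Tendsto Q.h Filter.atTop Filter.atTop)
    -- different groups are heterogeneous
    (h_het : ∀ k l, k ≠ l → ¬(Q.c k = Q.c l ∧ Q.mu k = Q.mu l))
    -- scale economies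
    (h_sorted : Monotone fun k => Q.c k / Q.mu k) (h_scale : Antitone Q.mu)
    (d : ℕ → Fin K → ℕ) (η : ℝ) (hd : Q.IsOptimal d η) :
    (∃ g, Q.IsPotential d η g) ∧
    ∀ g, Q.IsPotential d η g →
      ∃ θ : Fin K → ℕ,
        (∀ k, IsLeast {n | 1 ≤ n ∧ Q.c k / Q.mu k < GroupServerQueue.prf g n} (θ k)) ∧
        Monotone θ ∧
        (∀ n k, θ k ≤ n → d n k = Q.maxOn d n k) ∧
        (∀ n k, n < θ k →
          d n k = 0 ∨ (1 ≤ n ∧ GroupServerQueue.prf g n = Q.c k / Q.mu k)) ∧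
        ∃ d', Q.IsMultiThreshold θ d' ∧ Q.IsOptimal d' η := by
  have hR := hd.1.rates hlam hmu
  obtain ⟨w, hw, hs⟩ := hd.exists_weight hlam hmu hc h_mono h_top
  have hpos (n : ℕ) : 0 < Q.deathRate d (n + 1) := hw.mu_pos hlam n.succ_pos
  refine ⟨exists_isPotential hR hw hs, fun g hg => ?_⟩
  have hG := hg.poissonEq hR hw hs
  have hB : Q.IsBellmanSolution d η (prf g) :=
    ⟨hd.1, hG, hd.isMaxOn_actionValue hlam hmu hw hs hG⟩
  have hGmono := hB.monotoneOn hmu h_sorted h_scale h_het hlam h_top hc h_convex hpos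
  obtain ⟨θ, hθ⟩ := hB.exists_isThreshold hmu h_sorted h_scale h_het hlam h_top hGmono
  have hθmono := hθ.monotone h_sorted
  refine ⟨θ, hθ, hθmono,
    fun n k hn => hB.eq_maxOn hmu h_sorted h_scale h_het (hθ.lt_of_le hGmono hn),
    fun n k hn => hB.eq_zero_or_eq hmu hθ hn,
    Q.thresholdPolicy θ, isMultiThreshold_thresholdPolicy hθmono, ?_⟩
  obtain ⟨k, hkM, hk⟩ := exists_cheapest_group hd.1 hmu (hpos 0)
  have hθk : θ k ≤ 1 := (hθ k).2
    ⟨le_rfl, hB.lt_one hlam (holding_add_work_lt hd.1 hmu hk h_mono h_top hR.mu_zero hw hs)⟩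
  exact hd.of_poissonEq hlam hmu hw hs hG (isEfficient_thresholdPolicy Q θ)
    (fun n => deathRate_thresholdPolicy_pos hmu hθmono hkM (hθk.trans n.succ_pos) n.succ_pos)
    (hB.poissonEq_thresholdPolicy hmu h_sorted h_scale h_het hGmono hθ)
    fun n hn => hB.thresholdPolicy_eq hmu h_sorted h_scale h_het hGmono hθ hn.le
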